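/- Fix $n\ge 1$, $\epsilon>0$ and $\delta\in(0,1)$. **Mirror descent set-up.** Let $E$ be a finite-dimensional real normed space; gradients (elements of $E^*$) are measured in the dual norm. Let $\Theta\subset E$ be convex and compact, with diameter $R=\max_{\theta,\theta'\in\Theta}\|\theta-\theta'\|$. Let $\omega:\Theta\to\mathbb R$ be a distance-generating function, i.e. $\omega$ is continuous and strongly convex with modulus $1$, and its subdifferential admits a continuous selection $\omega'$ on the non-empty set $\Theta^o=\{\theta\in\Theta:\partial\omega(\theta)\ne\emptyset\}$. Put $V(w,u)=\omega(u)-\omega(w)-\langle\omega'(w),u-w\rangle$ for $w\in\Theta^o$ and $u\in\Theta$, $\theta^c=\operatorname{argmin}_{\theta\in\Theta^o}\omega(\theta)$, and let $D_\Theta=\max_{u\in\Theta}V(\theta^c,u)$ be the Bregman radius. **Group DRO problem.** Let $\mathcal Z$ be a set of datapoints and, for $\theta\in\Theta$ and $z\in\mathcal Z$, let $\ell(h_\theta,z)\in[0,1]$ be the loss of the model $h_\theta$ at $z$. For every $z$ the map $\theta\mapsto\ell(h_\theta,z)$ is convex and differentiable on $\Theta$ with $\|\nabla_\theta\ell(h_\theta,z)\|_*\le1$.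 For each group $i\in\{1,\dots,n\}$ let $B_i$ be an arbitrary non-empty finite batch of datapoints (for instance, any realization of an i.i.d. batch drawn from a data distribution $D_i$), let $D_i'$ be its empirical distribution, and $\mathcal R_{D_i'}(h_\theta)=\mathbb E_{z\sim D_i'}[\ell(h_\theta,z)]$. A parameter $\theta\in\Theta$ is *empirically $\epsilon$-optimal* if $$\max_i\mathcal R_{D_i'}(h_\theta)\le\min_{\theta^*\in\Theta}\max_i\mathcal R_{D_i'}(h_{\theta^*})+\epsilon .$$ **Algorithm.** Given step sizes $\eta,\kappa>0$, an exploration parameter $\lambda>0$ and a number $T$ of iterations, start with $\theta^{(1)}=\theta^c$ and $c^{(1)}=0\in\mathbb R^n$. In iteration $t=1,\dots,T$ let $w^{(t)}$ be the probability vector with $w^{(t)}_i\propto\exp(-\kappa c^{(t)}_i)$. Draw a group $i\sim w^{(t)}$ and a datapoint $z\sim D_i'$, and independently a group $j\sim w^{(t)}$ and a datapoint $z'\sim D_j'$; make the mirror descent step $$\theta^{(t+1)}=\operatorname{argmin}_{u\in\Theta}\big(\eta\langle\nabla_\theta\ell(h_{\theta^{(t)}},z),u\rangle+V(\theta^{(t)},u)\big),$$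 and set $c^{(t+1)}=c^{(t)}+\frac{1-\ell(h_{\theta^{(t)}},z')}{w^{(t)}_j+\lambda}\,e_j$. Output $\bar\theta=\frac1T\sum_{t=1}^T\theta^{(t)}$. **Claim.** There is a universal constant $C>0$ such that for all $E,\Theta,\omega,\omega',n,\epsilon,\delta$ as above and every integer $$T\ \ge\ \frac{C}{\epsilon^2}\Big(D_\Theta+n\log(n/\delta)+R\log(1/\delta)\Big),$$ there are parameters $\eta,\kappa,\lambda>0$, chosen before $\mathcal Z$, the loss and the batches are given, such that for every group DRO problem as above and all batches, the output $\bar\theta$ of $T$ iterations of the algorithm is empirically $\epsilon$-optimal with probability at least $1-\delta$ over the randomness of the algorithm. In particular $O\big(\epsilon^{-2}(D_\Theta+n\log(n/\delta)+R\log(1/\delta))\big)$ mirror descent iterations (rounded up to an integer), each using only two sampled datapoints, suffice. -/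

import Mathlib

noncomputable section

namespace GroupDRO

/-! ### Mirror descent set-up

The parameter set `Θ` lies in a finite-dimensional normed space `E`. The norm of `E` measures
parameters; gradients live in the dual space and are measured in the dual (operator) norm. -/

section Mirror

variable {E : Type*} [NormedAddCommGroup E] [NormedSpace ℝ E]

/-- The subdifferential at `θ` of a function `ω` with domain `Θ`. -/
def subdifferential (Θ : Set E) (ω : E → ℝ) (θ : E) : Set (E →L[ℝ] ℝ) :=
  {g | ∀ u ∈ Θ, ω θ + g (u - θ) ≤ ω u}

/-- The set `Θ°` of the points of `Θ` at which the subdifferential of `ω` is non-empty. -/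
def subdiffDomain (Θ : Set E) (ω : E → ℝ) : Set E :=
  {θ | θ ∈ Θ ∧ (subdifferential Θ ω θ).Nonempty}

/-- `ω` is a distance-generating function on `Θ`, and `ω'` is a continuous selection of its
subdifferential on `Θ°`. -/
structure IsDGF (Θ : Set E) (ω : E → ℝ) (ω' : E → (E →L[ℝ] ℝ)) : Prop where
  continuousOn : ContinuousOn ω Θ
  strongConvexOn : StrongConvexOn Θ 1 ω
  nonempty : (subdiffDomain Θ ω).Nonempty
  selection : ∀ θ ∈ subdiffDomain Θ ω, ω' θ ∈ subdifferential Θ ω θ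
  continuousOn_selection : ContinuousOn ω' (subdiffDomain Θ ω)

/-- `θc` is the center of `Θ`: the minimizer of `ω` over `Θ°`. -/
def IsCenter (Θ : Set E) (ω : E → ℝ) (θc : E) : Prop :=
  θc ∈ subdiffDomain Θ ω ∧ IsMinOn ω (subdiffDomain Θ ω) θc

/-- The prox function (Bregman divergence) `V(w, u) = ω(u) - ω(w) - ⟨ω'(w), u - w⟩`. -/
def bregman (ω : E → ℝ) (ω' : E → (E →L[ℝ] ℝ)) (w u : E) : ℝ :=
  ω u - ω w - ω' w (u - w)

/-- The Bregman radius `max_{u ∈ Θ} V(θc, u)`. -/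
def bregmanRadius (Θ : Set E) (ω : E → ℝ) (ω' : E → (E →L[ℝ] ℝ)) (θc : E) : ℝ :=
  sSup (bregman ω ω' θc '' Θ)

/-- One mirror descent step from `θ` with step size `η` and cost gradient `g`:
the point `argmin_{u ∈ Θ} (η ⟨g, u⟩ + V(θ, u))`. -/
def mirrorStep (Θ : Set E) (ω : E → ℝ) (ω' : E → (E →L[ℝ] ℝ)) (η : ℝ) (θ : E)
    (g : E →L[ℝ] ℝ) : E :=
  Classical.epsilon fun p => p ∈ Θ ∧ IsMinOn (fun u => η * g u + bregman ω ω' θ u) Θ p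

end Mirror

/-! ### The learning problem -/

section Problem

variable {E : Type*} [NormedAddCommGroup E] [NormedSpace ℝ E] {Z : Type*}

/-- `loss θ z`, the loss `ℓ(h_θ, z)` of the model with parameter `θ` at the datapoint `z`, takes
values in `[0, 1]`, and is convex and differentiable in `θ ∈ Θ` with gradient `grad θ z` of
(dual) norm at most `1`. -/
structure IsSmoothConvexLoss (Θ : Set E) (loss : E → Z → ℝ) (grad : E → Z → (E →L[ℝ] ℝ)) :
    Prop where
  mem_Icc : ∀ θ ∈ Θ, ∀ z, loss θ z ∈ Set.Icc (0 : ℝ) 1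
  convexOn : ∀ z, ConvexOn ℝ Θ fun θ => loss θ z
  hasGradient : ∀ z, ∀ θ ∈ Θ, HasFDerivWithinAt (fun θ => loss θ z) (grad θ z) Θ θ
  norm_le : ∀ z, ∀ θ ∈ Θ, ‖grad θ z‖ ≤ 1

/-- The empirical distribution of a non-empty batch `b 0, …, b (k - 1)`. -/
def empirical {k : ℕ} [NeZero k] (b : Fin k → Z) : PMF Z :=
  (PMF.uniformOfFintype (Fin k)).map b

/-- The risk `E_{z ∼ D} ℓ(h_θ, z)`. -/
def risk (loss : E → Z → ℝ) (D : PMF Z) (θ : E) : ℝ :=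
  ∑' z, (D z).toReal * loss θ z

/-- The worst-case risk `max_i R_{D_i}(h_θ)`. -/
def worstRisk {n : ℕ} (loss : E → Z → ℝ) (D : Fin n → PMF Z) (θ : E) : ℝ :=
  ⨆ i, risk loss (D i) θ

/-- `OPT = min_{θ ∈ Θ} max_i R_{D_i}(h_θ)`. -/
def opt {n : ℕ} (Θ : Set E) (loss : E → Z → ℝ) (D : Fin n → PMF Z) : ℝ :=
  ⨅ θ : Θ, worstRisk loss D (θ : E)

/-- `θ` is a (proper) `ε`-optimal solution for the distributions `D 0, …, D (n - 1)`. -/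
def IsEpsOptimal {n : ℕ} (Θ : Set E) (loss : E → Z → ℝ) (D : Fin n → PMF Z) (ε : ℝ) (θ : E) :
    Prop :=
  θ ∈ Θ ∧ worstRisk loss D θ ≤ opt Θ loss D + ε

end Problem

/-! ### The algorithm -/

section Hedge

variable {n : ℕ}

/-- Exponential weights for the cumulative cost vector `c`. -/
def hedgeWeight (η : ℝ) (c : Fin n → ℝ) (i : Fin n) : ℝ :=
  Real.exp (-η * c i) / ∑ j, Real.exp (-η * c j)

theorem sum_ofReal_hedgeWeight [NeZero n] (η : ℝ) (c : Fin n → ℝ) :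
    ∑ i, ENNReal.ofReal (hedgeWeight η c i) = 1 := by
  have hpos : 0 < ∑ j, Real.exp (-η * c j) :=
    Finset.sum_pos (fun j _ => Real.exp_pos _) Finset.univ_nonempty
  have hnn : ∀ i ∈ Finset.univ, 0 ≤ hedgeWeight η c i := fun i _ =>
    div_nonneg (Real.exp_pos _).le hpos.le
  rw [← ENNReal.ofReal_sum_of_nonneg hnn]
  simp only [hedgeWeight]
  rw [← Finset.sum_div, div_self hpos.ne', ENNReal.ofReal_one]

/-- The exponential weights as a probability distribution on the groups. -/
def hedge [NeZero n] (η : ℝ) (c : Fin n → ℝ) : PMF (Fin n) :=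
  PMF.ofFintype (fun i => ENNReal.ofReal (hedgeWeight η c i)) (sum_ofReal_hedgeWeight η c)

end Hedge

/-- The memory of the algorithm: the learner's current parameter, the auditor's cumulative
estimated costs, and the sum of the learner's previous parameters. -/
structure AlgState (E : Type*) (n : ℕ) where
  point : E
  cost : Fin n → ℝ
  total : E

section Algorithm

variable {E : Type*} [NormedAddCommGroup E] [NormedSpace ℝ E] {Z : Type*} {n : ℕ} [NeZero n]

/-- One iteration, with learner's step size `η`, auditor's step size `κ` and implicit exploration
`lam`. The auditor's mixture `w` is the vector of exponential weights. A group `i ∼ w` and a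
datapoint `z ∼ D i` are drawn, and the learner makes a mirror descent step with the gradient of
the loss at `z`. Independently a group `j ∼ w` and a datapoint `z' ∼ D j` are drawn, and the
auditor adds the estimate `(1 - ℓ(h_θ, z')) / (w j + lam)` to the cumulative cost of group `j`. -/
def iteration (Θ : Set E) (ω : E → ℝ) (ω' : E → (E →L[ℝ] ℝ))
    (loss : E → Z → ℝ) (grad : E → Z → (E →L[ℝ] ℝ)) (D : Fin n → PMF Z) (η κ lam : ℝ)
    (s : AlgState E n) : PMF (AlgState E n) :=
  (hedge κ s.cost).bind fun i => (D i).bind fun z =>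
  (hedge κ s.cost).bind fun j => (D j).bind fun z' =>
  PMF.pure
    { point := mirrorStep Θ ω ω' η s.point (grad s.point z)
      cost := s.cost +
        Pi.single j ((1 - loss s.point z') / (hedgeWeight κ s.cost j + lam))
      total := s.total + s.point }

/-- The law of the memory after `t` iterations, started at the parameter `θc`. -/
def run (Θ : Set E) (ω : E → ℝ) (ω' : E → (E →L[ℝ] ℝ)) (θc : E)
    (loss : E → Z → ℝ) (grad : E → Z → (E →L[ℝ] ℝ)) (D : Fin n → PMF Z) (η κ lam : ℝ) :
    ℕ → PMF (AlgState E n)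
  | 0 => PMF.pure { point := θc, cost := 0, total := 0 }
  | t + 1 => (run Θ ω ω' θc loss grad D η κ lam t).bind
      (iteration Θ ω ω' loss grad D η κ lam)

/-- The law of the output after `T` iterations: the average `(1 / T) ∑ θ⁽ᵗ⁾` of the learner's
parameters. -/
def output (Θ : Set E) (ω : E → ℝ) (ω' : E → (E →L[ℝ] ℝ)) (θc : E)
    (loss : E → Z → ℝ) (grad : E → Z → (E →L[ℝ] ℝ)) (D : Fin n → PMF Z) (η κ lam : ℝ)
    (T : ℕ) : PMF E :=
  (run Θ ω ω' θc loss grad D η κ lam T).map fun s => (T : ℝ)⁻¹ • s.total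

end Algorithm

end GroupDRO

end

open scoped ENNReal

namespace GroupDRO

/-! The algorithm is a zero-sum game: the learner runs stochastic mirror descent, the auditor runs
exponential weights on bandit estimates with implicit exploration. Fix a group `i` and a comparator
`u` with worst risk below `opt + ε / 4`. The proof follows one `potential`, V(θ, u)/η + `logSumExp`
of the costs + the estimated cost of `i`. It is nonnegative, because the log-sum-exp dominates minus
each coordinate, and it starts below D_Θ/η + log n/κ.

In one iteration its expected growth is at most the `w`-average risk of `u` minus the risk of group
`i` at the current point, up to O(ε): the `w`-average risks of the current point, contributed by
learner and auditor with opposite signs, cancel. `expect_iteration_exp_potential_le` proves this at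
the level of exponential moments with parameter β ~ ε/n, so `expect_tracked_exp_le` yields a
supermartingale. Markov's inequality and convexity (`output_risk_tail`) bound the probability that
group `i` has large risk at the average by δ/n, and a union bound over groups concludes.

Convexity is applied at the sampled datapoint, before any expectation is taken. The learner's noise
is then a difference of losses, bounded by 1, instead of a linearized regret bounded by the
diameter. -/

theorem nonneg_of_forall_add_sq {a b : ℝ} (h : ∀ t : ℝ, 0 < t → t ≤ 1 → 0 ≤ t * a + t ^ 2 * b) :
    0 ≤ a := by
  by_contra! ha
  have hd : 0 < |b| - a := by have := abs_nonneg b; linarith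
  have ht : 0 < -a / (2 * (|b| - a)) := div_pos (by linarith) (by linarith)
  have h1 := h (-a / (2 * (|b| - a))) ht (by
    rw [div_le_one (by linarith)]; have := abs_nonneg b; linarith)
  have h2 : 0 ≤ a + -a / (2 * (|b| - a)) * b := by
    have : 0 ≤ -a / (2 * (|b| - a)) * (a + -a / (2 * (|b| - a)) * b) := by
      convert h1 using 1; ring
    exact nonneg_of_mul_nonneg_right this ht
  have h3 : -a / (2 * (|b| - a)) * b ≤ -a / 2 := by
    calc -a / (2 * (|b| - a)) * b ≤ -a / (2 * (|b| - a)) * (|b| - a) := by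
          apply mul_le_mul_of_nonneg_left _ ht.le
          have := le_abs_self b; linarith
      _ = -a / 2 := by field_simp
  linarith

/-! ### Mirror descent with a selection of subgradients that is defined only on Θ°. -/

section Mirror

variable {E : Type*} [NormedAddCommGroup E] [NormedSpace ℝ E]
  {Θ : Set E} {ω : E → ℝ} {ω' : E → (E →L[ℝ] ℝ)}

theorem segment_point_eq (x u : E) (t : ℝ) : (1 - t) • x + t • u = x + t • (u - x) := by
  rw [sub_smul, smul_sub, one_smul]; abel

theorem add_gradient_le_of_convexOn {f : E → ℝ} {g : E →L[ℝ] ℝ} {x u : E}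
    (hf : ConvexOn ℝ Θ f) (hx : x ∈ Θ) (hu : u ∈ Θ) (hg : HasFDerivWithinAt f g Θ x) :
    f x + g (u - x) ≤ f u := by
  have hmem : ∀ t ∈ Set.Icc (0 : ℝ) 1, x + t • (u - x) ∈ Θ := fun t ht => by
    rw [← segment_point_eq]
    exact hf.1 hx hu (by linarith [ht.2]) ht.1 (by ring)
  have hline : HasDerivWithinAt (fun t : ℝ => x + t • (u - x)) (u - x) (Set.Icc 0 1) 0 := by
    simpa using (((hasDerivAt_id (0 : ℝ)).smul_const (u - x)).const_add x).hasDerivWithinAt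
  have hd : HasDerivWithinAt (fun t : ℝ => f (x + t • (u - x))) (g (u - x)) (Set.Icc 0 1) 0 := by
    have hg' : HasFDerivWithinAt f g Θ (x + (0 : ℝ) • (u - x)) := by simpa using hg
    exact hg'.comp_hasDerivWithinAt (0 : ℝ) hline hmem
  have hd' := hd.mono (Set.Ioc_subset_Icc_self)
  rw [hasDerivWithinAt_iff_tendsto_slope' (by simp)] at hd'
  have hne : (nhdsWithin (0 : ℝ) (Set.Ioc 0 1)).NeBot := by
    rw [nhdsWithin_Ioc_eq_nhdsGT one_pos]; infer_instance
  have := le_of_tendsto hd' (b := f u - f x) (by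
    filter_upwards [self_mem_nhdsWithin] with t ht
    rw [slope_def_field, div_le_iff₀ (by linarith [ht.1])]
    have h := hf.2 hx hu (show 0 ≤ 1 - t by linarith [ht.2]) ht.1.le (by ring)
    rw [segment_point_eq] at h
    simp only [smul_eq_mul] at h
    simp only [zero_smul, add_zero, sub_zero]
    linarith)
  linarith

theorem half_sq_norm_le_bregman (hω : IsDGF Θ ω ω') {θ u : E} (hθ : θ ∈ subdiffDomain Θ ω)
    (hu : u ∈ Θ) : 1 / 2 * ‖u - θ‖ ^ 2 ≤ bregman ω ω' θ u := by
  rw [← sub_nonneg]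
  refine nonneg_of_forall_add_sq (b := 1 / 2 * ‖u - θ‖ ^ 2) fun t ht0 ht1 => ?_
  have h1 := hω.strongConvexOn.2 hθ.1 hu (show 0 ≤ 1 - t by linarith) ht0.le (by ring)
  have hm := hω.strongConvexOn.1 hθ.1 hu (show 0 ≤ 1 - t by linarith) ht0.le (by ring)
  rw [segment_point_eq] at h1 hm
  have h2 := hω.selection θ hθ _ hm
  simp only [smul_eq_mul, add_sub_cancel_left, map_smul] at h1 h2
  rw [norm_sub_rev] at h1
  unfold bregman
  nlinarith

theorem bregman_nonneg (hω : IsDGF Θ ω ω') {θ u : E} (hθ : θ ∈ subdiffDomain Θ ω)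
    (hu : u ∈ Θ) : 0 ≤ bregman ω ω' θ u :=
  le_trans (by positivity) (half_sq_norm_le_bregman hω hθ hu)

theorem continuousOn_bregman (hω : IsDGF Θ ω ω') (θ : E) :
    ContinuousOn (bregman ω ω' θ) Θ := by
  unfold bregman
  exact (hω.continuousOn.sub continuousOn_const).sub (by fun_prop)

theorem bregman_le_bregmanRadius (hΘ : IsCompact Θ) (hω : IsDGF Θ ω ω') (θ : E) {u : E}
    (hu : u ∈ Θ) : bregman ω ω' θ u ≤ bregmanRadius Θ ω ω' θ :=
  le_csSup (hΘ.image_of_continuousOn (continuousOn_bregman hω θ)).bddAbove ⟨u, hu, rfl⟩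

theorem mirrorStep_spec (hΘ : IsCompact Θ) (hω : IsDGF Θ ω ω') (η : ℝ) (θ : E)
    (g : E →L[ℝ] ℝ) :
    mirrorStep Θ ω ω' η θ g ∈ Θ ∧
      IsMinOn (fun u => η * g u + bregman ω ω' θ u) Θ (mirrorStep Θ ω ω' η θ g) := by
  have hne : Θ.Nonempty := hω.nonempty.mono fun _ h => h.1
  have hc : ContinuousOn (fun u => η * g u + bregman ω ω' θ u) Θ :=
    ContinuousOn.add (by fun_prop) (continuousOn_bregman hω θ)
  obtain ⟨p, hp, hmin⟩ := hΘ.exists_isMinOn hne hc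
  exact Classical.epsilon_spec
    (p := fun p => p ∈ Θ ∧ IsMinOn (fun u => η * g u + bregman ω ω' θ u) Θ p) ⟨p, hp, hmin⟩

/-- V(θ, ·) differs from `ω` by an affine function, so minimality is itself a subgradient
inequality. It also shows that the iterates stay in Θ°. -/
theorem mirrorStep_subgradient (hΘ : IsCompact Θ) (hω : IsDGF Θ ω ω') (η : ℝ) (θ : E)
    (g : E →L[ℝ] ℝ) :
    ω' θ - η • g ∈ subdifferential Θ ω (mirrorStep Θ ω ω' η θ g) := by
  intro u hu
  have h := (mirrorStep_spec hΘ hω η θ g).2 hu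
  simp only [bregman, Set.mem_ofPred_eq, map_sub] at h
  simp only [sub_apply, smul_apply, smul_eq_mul, map_sub]
  linarith

theorem mirrorStep_mem_subdiffDomain (hΘ : IsCompact Θ) (hω : IsDGF Θ ω ω') (η : ℝ) (θ : E)
    (g : E →L[ℝ] ℝ) : mirrorStep Θ ω ω' η θ g ∈ subdiffDomain Θ ω :=
  ⟨(mirrorStep_spec hΘ hω η θ g).1, _, mirrorStep_subgradient hΘ hω η θ g⟩

/-- A minimizer of `ω` plus a Euclidean quadratic is a point of subdifferentiability. -/
theorem mem_subdiffDomain_of_isMinOn_add_sq {F : Type*} [NormedAddCommGroup F]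
    [InnerProductSpace ℝ F] (L : E →L[ℝ] F) (hconv : ConvexOn ℝ Θ ω) {q v : E} {M : ℝ}
    (hv : v ∈ Θ) (hmin : IsMinOn (fun x => ω x + M * ‖L (x - q)‖ ^ 2) Θ v) :
    v ∈ subdiffDomain Θ ω := by
  refine ⟨hv, (-(2 * M)) • ((innerSL ℝ (L (v - q))).comp L), fun u hu => ?_⟩
  rw [← sub_nonneg]
  refine nonneg_of_forall_add_sq (b := M * ‖L (u - v)‖ ^ 2) fun t ht0 ht1 => ?_
  have h1 := hconv.2 hv hu (show 0 ≤ 1 - t by linarith) ht0.le (by ring)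
  have hm := hconv.1 hv hu (show 0 ≤ 1 - t by linarith) ht0.le (by ring)
  rw [segment_point_eq] at h1 hm
  have h2 := hmin hm
  have h3 : ‖L (v + t • (u - v) - q)‖ ^ 2
      = ‖L (v - q)‖ ^ 2 + 2 * t * inner ℝ (L (v - q)) (L (u - v))
        + t ^ 2 * ‖L (u - v)‖ ^ 2 := by
    have : v + t • (u - v) - q = (v - q) + t • (u - v) := by abel
    rw [this, map_add, map_smul, norm_add_sq_real, inner_smul_right, norm_smul, mul_pow,
      Real.norm_eq_abs, sq_abs]
    ring
  simp only [Set.mem_ofPred_eq, h3] at h2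
  simp only [smul_eq_mul] at h1
  simp only [smul_apply, ContinuousLinearMap.comp_apply, innerSL_apply_apply,
    smul_eq_mul]
  nlinarith

/-- Density of Θ° in Θ by penalization: a minimizer of `ω` plus M times a squared Euclidean distance
to `q` lies in Θ°, and is close to `q` once M is large compared with the oscillation of `ω`. The
norm of `E` need not be smooth, hence the passage to an inner product space. -/
theorem exists_subdiffDomain_near_of_equiv {F : Type*} [NormedAddCommGroup F]
    [InnerProductSpace ℝ F] (L : E ≃L[ℝ] F) (hΘ : IsCompact Θ) (hω : IsDGF Θ ω ω')
    {q : E} (hq : q ∈ Θ) {r : ℝ} (hr : 0 < r) : ∃ v ∈ subdiffDomain Θ ω, ‖v - q‖ < r := by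
  have hconv : ConvexOn ℝ Θ ω := by
    exact UniformConvexOn.convexOn hω.strongConvexOn
      (Pi.le_def.2 fun r => mul_nonneg (by norm_num) (sq_nonneg r))
  obtain ⟨m, hm⟩ := (hΘ.image_of_continuousOn hω.continuousOn).bddBelow
  have hm' : ∀ u ∈ Θ, m ≤ ω u := fun u hu => hm ⟨u, hu, rfl⟩
  obtain ⟨K, hK0, hK⟩ : ∃ K : ℝ, 0 ≤ K ∧ ∀ x, ‖x‖ ≤ K * ‖L x‖ :=
    ⟨‖(L.symm : F →L[ℝ] E)‖, norm_nonneg _, fun x => by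
      simpa using (L.symm : F →L[ℝ] E).le_opNorm (L x)⟩
  have hgap : 0 ≤ ω q - m := sub_nonneg.2 (hm' q hq)
  obtain ⟨M, hM⟩ : ∃ M : ℝ, M = (K ^ 2 + 1) * (ω q - m + 1) / r ^ 2 := ⟨_, rfl⟩
  have hM0 : 0 < M := by rw [hM]; positivity
  have hc : ContinuousOn (fun x => ω x + M * ‖L (x - q)‖ ^ 2) Θ :=
    hω.continuousOn.add (by fun_prop)
  obtain ⟨v, hv, hmin⟩ := hΘ.exists_isMinOn ⟨q, hq⟩ hc
  refine ⟨v, mem_subdiffDomain_of_isMinOn_add_sq (L : E →L[ℝ] F) hconv hv hmin, ?_⟩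
  have h1 := hmin hq
  simp only [Set.mem_ofPred_eq, sub_self, map_zero, norm_zero] at h1
  have h2 : M * ‖L (v - q)‖ ^ 2 ≤ ω q - m := by have := hm' v hv; linarith
  have h3 := hK (v - q)
  have h4 : ‖v - q‖ ^ 2 ≤ K ^ 2 * ‖L (v - q)‖ ^ 2 := by
    rw [← mul_pow]; exact pow_le_pow_left₀ (norm_nonneg _) h3 2
  have h5 : (K ^ 2 + 1) * (ω q - m + 1) * ‖L (v - q)‖ ^ 2 ≤ (ω q - m) * r ^ 2 := by
    have h6 : M * r ^ 2 = (K ^ 2 + 1) * (ω q - m + 1) := by rw [hM]; field_simp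
    calc _ = M * ‖L (v - q)‖ ^ 2 * r ^ 2 := by rw [← h6]; ring
      _ ≤ _ := mul_le_mul_of_nonneg_right h2 (sq_nonneg r)
  have h7 : (ω q - m + 1) * ‖v - q‖ ^ 2 < (ω q - m + 1) * r ^ 2 := by
    have : 0 < r ^ 2 := by positivity
    nlinarith [mul_le_mul_of_nonneg_left h4 (by linarith : 0 ≤ ω q - m + 1),
      mul_nonneg (by linarith : 0 ≤ ω q - m + 1) (sq_nonneg ‖L (v - q)‖)]
  exact lt_of_pow_lt_pow_left₀ 2 hr.le (lt_of_mul_lt_mul_left h7 (by linarith))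

theorem exists_subdiffDomain_near [FiniteDimensional ℝ E] (hΘ : IsCompact Θ)
    (hω : IsDGF Θ ω ω') {q : E} (hq : q ∈ Θ) {r : ℝ} (hr : 0 < r) :
    ∃ v ∈ subdiffDomain Θ ω, ‖v - q‖ < r :=
  exists_subdiffDomain_near_of_equiv (toEuclidean (E := E)) hΘ hω hq hr

variable [FiniteDimensional ℝ E]

/-- The continuous selection is the smallest subgradient in the directions of `Θ`. -/
theorem subgradient_le_selection (hconv : Convex ℝ Θ) (hΘ : IsCompact Θ) (hω : IsDGF Θ ω ω')
    {p u : E} {g : E →L[ℝ] ℝ} (hp : p ∈ Θ) (hg : g ∈ subdifferential Θ ω p) (hu : u ∈ Θ) :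
    g (u - p) ≤ ω' p (u - p) := by
  have hpd : p ∈ subdiffDomain Θ ω := ⟨hp, g, hg⟩
  let t : ℕ → ℝ := fun k => 1 / ((k : ℝ) + 1)
  have ht0 : ∀ k, 0 < t k := fun k => by positivity
  have ht1 : ∀ k, t k ≤ 1 := fun k => by
    have : (0 : ℝ) ≤ k := k.cast_nonneg
    simp only [t]; rw [div_le_one (by positivity)]; linarith
  have ht : Filter.Tendsto t Filter.atTop (nhds 0) := tendsto_one_div_add_atTop_nhds_zero_nat
  -- The segment from `p` to `u` may avoid Θ°, so it is approximated. The error t² is negligible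
  -- against the displacement t, and survives division by t in the monotonicity inequality.
  have hex : ∀ k, ∃ v ∈ subdiffDomain Θ ω, ‖v - (p + t k • (u - p))‖ < t k ^ 2 := fun k => by
    refine exists_subdiffDomain_near hΘ hω ?_ (pow_pos (ht0 k) 2)
    rw [← segment_point_eq]
    exact hconv hp hu (by linarith [ht1 k]) (ht0 k).le (by ring)
  choose v hv hvn using hex
  have hvlim : Filter.Tendsto v Filter.atTop (nhds p) := by
    have hq : Filter.Tendsto (fun k => p + t k • (u - p)) Filter.atTop (nhds p) := by
      simpa using (ht.smul_const (u - p)).const_add p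
    have hz : Filter.Tendsto (fun k => v k - (p + t k • (u - p))) Filter.atTop (nhds 0) :=
      squeeze_zero_norm (fun k => (hvn k).le) (by simpa using ht.pow 2)
    simpa using hz.add hq
  have hωlim : Filter.Tendsto (fun k => ω' (v k)) Filter.atTop (nhds (ω' p)) :=
    (hω.continuousOn_selection p hpd).tendsto.comp
      (tendsto_nhdsWithin_iff.2 ⟨hvlim, Filter.Eventually.of_forall hv⟩)
  have hlhs : Filter.Tendsto (fun k => (ω' (v k) - g) (u - p)) Filter.atTop
      (nhds ((ω' p - g) (u - p))) :=
    ((ContinuousLinearMap.apply ℝ ℝ (u - p)).continuous.tendsto _).comp (hωlim.sub_const g)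
  have hrhs : Filter.Tendsto (fun k => -(‖ω' (v k) - g‖ * t k)) Filter.atTop (nhds 0) := by
    simpa using ((hωlim.sub_const g).norm.mul ht).neg
  have hmono : ∀ k, -(‖ω' (v k) - g‖ * t k) ≤ (ω' (v k) - g) (u - p) := fun k => by
    have h1 := hω.selection _ (hv k) p hp
    have h2 := hg (v k) (hv k).1
    have h3 : 0 ≤ (ω' (v k) - g) (v k - p) := by
      have h4 : ω' (v k) (p - v k) = - ω' (v k) (v k - p) := by rw [← map_neg, neg_sub]
      rw [sub_apply]; linarith
    have h5 : v k - p = t k • (u - p) + (v k - (p + t k • (u - p))) := by abel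
    rw [h5, map_add, map_smul, smul_eq_mul] at h3
    have h6 : (ω' (v k) - g) (v k - (p + t k • (u - p))) ≤ ‖ω' (v k) - g‖ * t k ^ 2 :=
      (le_abs_self _).trans (((ω' (v k) - g).le_opNorm _).trans
        (mul_le_mul_of_nonneg_left (hvn k).le (norm_nonneg _)))
    have h7 : 0 ≤ t k * ((ω' (v k) - g) (u - p) + ‖ω' (v k) - g‖ * t k) := by nlinarith
    have := nonneg_of_mul_nonneg_right h7 (ht0 k)
    linarith
  have := le_of_tendsto_of_tendsto' hrhs hlhs hmono
  rw [sub_apply] at this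
  linarith

/-- The usual three-point argument. Optimality of `p` only supplies the subgradient `ω' θ - η • g`,
whereas V(p, u) is built from `ω' p`; `subgradient_le_selection` compares the two in the direction
of `u`. -/
theorem mirrorStep_regret (hconv : Convex ℝ Θ) (hΘ : IsCompact Θ) (hω : IsDGF Θ ω ω')
    {η : ℝ} (hη : 0 < η) {θ u : E} (hθ : θ ∈ subdiffDomain Θ ω) (hu : u ∈ Θ)
    {g : E →L[ℝ] ℝ} (hg : ‖g‖ ≤ 1) :
    g (θ - u) ≤ (bregman ω ω' θ u - bregman ω ω' (mirrorStep Θ ω ω' η θ g) u) / η + η / 2 := by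
  set p := mirrorStep Θ ω ω' η θ g with hp
  have hpd : p ∈ subdiffDomain Θ ω := mirrorStep_mem_subdiffDomain hΘ hω η θ g
  have h1 := subgradient_le_selection hconv hΘ hω hpd.1 (mirrorStep_subgradient hΘ hω η θ g) hu
  have h2 := half_sq_norm_le_bregman hω hθ hpd.1
  have h3 : g (θ - p) ≤ ‖p - θ‖ := by
    rw [norm_sub_rev]
    exact (le_abs_self _).trans ((g.le_opNorm _).trans
      (mul_le_of_le_one_left (norm_nonneg _) hg))
  have h4 : η * g (θ - u) ≤ bregman ω ω' θ u - bregman ω ω' p u + η ^ 2 / 2 := by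
    simp only [sub_apply, smul_apply, smul_eq_mul,
      bregman, map_sub] at h1 h2 h3 ⊢
    nlinarith [sq_nonneg (η - ‖p - θ‖), mul_le_mul_of_nonneg_left h3 hη.le]
  have h5 : g (θ - u) = η * g (θ - u) / η := by field_simp
  rw [h5, div_le_iff₀ hη]
  have : ((bregman ω ω' θ u - bregman ω ω' p u) / η + η / 2) * η
    = bregman ω ω' θ u - bregman ω ω' p u + η ^ 2 / 2 := by field_simp
  linarith

end Mirror

/-! ### Expectations under discrete distributions, with values in `ℝ≥0∞`. -/

section Expectation

variable {α β : Type*}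

/-- The expectation of a nonnegative function under a discrete distribution. -/
noncomputable def expect (p : PMF α) (f : α → ℝ≥0∞) : ℝ≥0∞ := ∑' a, p a * f a

theorem expect_pure (a : α) (f : α → ℝ≥0∞) : expect (PMF.pure a) f = f a := by
  unfold expect
  rw [tsum_eq_single a (fun b hb => by simp [PMF.pure_apply, hb])]
  simp [PMF.pure_apply]

theorem expect_bind (p : PMF α) (q : α → PMF β) (f : β → ℝ≥0∞) :
    expect (p.bind q) f = expect p fun a => expect (q a) f := by
  simp only [expect, PMF.bind_apply, ← ENNReal.tsum_mul_right, ← ENNReal.tsum_mul_left]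
  rw [ENNReal.tsum_comm]
  simp only [mul_assoc]

theorem expect_map (p : PMF α) (g : α → β) (f : β → ℝ≥0∞) :
    expect (p.map g) f = expect p fun a => f (g a) := by
  simp only [← PMF.bind_pure_comp, expect_bind, Function.comp_apply, expect_pure]

theorem expect_mono {p : PMF α} {f g : α → ℝ≥0∞} (h : ∀ a ∈ p.support, f a ≤ g a) :
    expect p f ≤ expect p g := by
  refine ENNReal.tsum_le_tsum fun a => ?_
  by_cases ha : a ∈ p.support
  · gcongr; exact h a ha
  · simp [(PMF.apply_eq_zero_iff p a).2 ha]

theorem expect_mul_const (p : PMF α) (f : α → ℝ≥0∞) (c : ℝ≥0∞) :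
    expect p (fun a => f a * c) = expect p f * c := by
  simp only [expect, ← ENNReal.tsum_mul_right, mul_assoc]

theorem expect_uniform [Fintype α] [Nonempty α] (f : α → ℝ≥0∞) :
    expect (PMF.uniformOfFintype α) f = ∑ a, (Fintype.card α : ℝ≥0∞)⁻¹ * f a := by
  simp [expect, tsum_fintype]

theorem toOuterMeasure_le_expect {p : PMF α} {S : Set α} {f : α → ℝ≥0∞}
    (h : ∀ a ∈ p.support, a ∈ S → 1 ≤ f a) : p.toOuterMeasure S ≤ expect p f := by
  rw [PMF.toOuterMeasure_apply]
  refine ENNReal.tsum_le_tsum fun a => ?_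
  by_cases ha : a ∈ S
  · by_cases hs : a ∈ p.support
    · simpa [ha] using le_mul_of_one_le_right (zero_le (a := p a)) (h a hs ha)
    · simp [(PMF.apply_eq_zero_iff p a).2 hs]
  · simp [ha]

theorem toOuterMeasure_compl_add (p : PMF α) (S : Set α) :
    1 ≤ p.toOuterMeasure S + p.toOuterMeasure Sᶜ := by
  have h : p.toOuterMeasure Set.univ = 1 := by
    rw [PMF.toOuterMeasure_apply_eq_one_iff]; exact Set.subset_univ _
  rw [← h, ← Set.union_compl_self S]
  exact MeasureTheory.measure_union_le S Sᶜ

end Expectation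

/-! ### Drawing a group and then a datapoint. -/

section Draws

variable {Z : Type*} {n : ℕ} {k : Fin n → ℕ}

theorem hedgeWeight_pos (κ : ℝ) (c : Fin n → ℝ) (i : Fin n) : 0 < hedgeWeight κ c i :=
  div_pos (Real.exp_pos _) (Finset.sum_pos (fun _ _ => Real.exp_pos _) ⟨i, Finset.mem_univ i⟩)

theorem sum_hedgeWeight [NeZero n] (κ : ℝ) (c : Fin n → ℝ) : ∑ i, hedgeWeight κ c i = 1 := by
  have hpos : 0 < ∑ j, Real.exp (-κ * c j) :=
    Finset.sum_pos (fun j _ => Real.exp_pos _) Finset.univ_nonempty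
  simp only [hedgeWeight]
  rw [← Finset.sum_div, div_self hpos.ne']

theorem expect_empirical {m : ℕ} [NeZero m] (b : Fin m → Z) (f : Z → ℝ≥0∞) :
    expect (empirical b) f = ∑ a, ENNReal.ofReal ((m : ℝ)⁻¹) * f (b a) := by
  rw [empirical, expect_map, expect_uniform, ENNReal.ofReal_inv_of_pos (by
    exact_mod_cast Nat.pos_of_ne_zero (NeZero.ne m))]
  simp

theorem risk_empirical {E : Type*} {m : ℕ} [NeZero m] (loss : E → Z → ℝ) (b : Fin m → Z) (θ : E) :
    risk loss (empirical b) θ = (m : ℝ)⁻¹ * ∑ a, loss θ (b a) := by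
  classical
  have hp : ∀ z, empirical b z = ∑ a, if z = b a then (m : ℝ≥0∞)⁻¹ else 0 := fun z => by
    simp [empirical, PMF.map_apply, tsum_fintype]
  have hfin : ∀ z, (empirical b z).toReal * loss θ z
      = ∑ a, if z = b a then (m : ℝ)⁻¹ * loss θ (b a) else 0 := fun z => by
    rw [hp, ENNReal.toReal_sum (fun a _ => by
      split_ifs <;> simp [NeZero.ne m]), Finset.sum_mul]
    refine Finset.sum_congr rfl fun a _ => ?_
    split_ifs with h
    · simp [h]
    · simp
  simp only [risk, hfin]
  rw [Summable.tsum_finsetSum (fun a _ => (hasSum_ite_eq (b a) _).summable), Finset.mul_sum]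
  simp only [tsum_ite_eq]

/-- Indexing a draw by its position in the batch, not by the datapoint, turns every expectation of
one iteration into a finite sum, whatever the type `Z`. -/
theorem expect_draw [NeZero n] [∀ i, NeZero (k i)] (κ : ℝ) (c : Fin n → ℝ)
    (B : (i : Fin n) → Fin (k i) → Z) (f : Fin n → Z → ℝ≥0∞) :
    (expect (hedge κ c) fun i => expect (empirical (B i)) fun z => f i z) =
      ∑ x : (i : Fin n) × Fin (k i),
        ENNReal.ofReal (hedgeWeight κ c x.1 * (k x.1 : ℝ)⁻¹) * f x.1 (B x.1 x.2) := by
  rw [Fintype.sum_sigma, expect, tsum_fintype]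
  refine Finset.sum_congr rfl fun i _ => ?_
  rw [expect_empirical, Finset.mul_sum]
  refine Finset.sum_congr rfl fun a _ => ?_
  rw [ENNReal.ofReal_mul (hedgeWeight_pos κ c i).le, mul_assoc]
  rfl

theorem sum_draw (w φ : Fin n → ℝ) (y : (i : Fin n) × Fin (k i) → ℝ) :
    ∑ x, w x.1 * (k x.1 : ℝ)⁻¹ * (φ x.1 * y x) =
      ∑ j, w j * φ j * ((k j : ℝ)⁻¹ * ∑ a, y ⟨j, a⟩) := by
  rw [Fintype.sum_sigma]
  refine Finset.sum_congr rfl fun j _ => ?_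
  rw [Finset.mul_sum, Finset.mul_sum]
  exact Finset.sum_congr rfl fun a _ => by ring

theorem sum_draw_weight [∀ i, NeZero (k i)] (w : Fin n → ℝ) :
    ∑ x : (i : Fin n) × Fin (k i), w x.1 * (k x.1 : ℝ)⁻¹ = ∑ j, w j := by
  have h := sum_draw (k := k) w (fun _ => 1) (fun _ => 1)
  simp only [mul_one] at h
  rw [h]
  refine Finset.sum_congr rfl fun j _ => ?_
  have : (k j : ℝ) ≠ 0 := by exact_mod_cast NeZero.ne (k j)
  simp [this]

end Draws

/-! ### Exponential moments of the learner's and the auditor's noise. -/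

section Moments

theorem exp_le_one_add_add_sq {x : ℝ} (h : |x| ≤ 1) : Real.exp x ≤ 1 + x + x ^ 2 := by
  have := (abs_le.1 (Real.abs_exp_sub_one_sub_id_le h)).2
  linarith

theorem exp_neg_le_quadratic {x : ℝ} (hx : 0 ≤ x) : Real.exp (-x) ≤ 1 - x + x ^ 2 / 2 := by
  have h1 := Real.quadratic_le_exp_of_nonneg hx
  have h0 : 0 < 1 + x + x ^ 2 / 2 := by positivity
  have h2 : 0 < 1 - x + x ^ 2 / 2 := by nlinarith [sq_nonneg (x - 1)]
  rw [Real.exp_neg, inv_le_comm₀ (Real.exp_pos _) h2]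
  refine le_trans ?_ h1
  rw [inv_le_iff_one_le_mul₀ h2]
  -- (1 + x + x²/2)(1 - x + x²/2) = 1 + x⁴/4.
  nlinarith [sq_nonneg (x ^ 2)]

variable {ι : Type*} [Fintype ι]

theorem sum_mul_exp_le {W Y : ι → ℝ} (hW : ∀ x, 0 ≤ W x) (hW1 : ∑ x, W x = 1)
    (hY : ∀ x, |Y x| ≤ 1) :
    ∑ x, W x * Real.exp (Y x) ≤ Real.exp (∑ x, W x * (Y x + Y x ^ 2)) := by
  calc ∑ x, W x * Real.exp (Y x) ≤ ∑ x, W x * (1 + (Y x + Y x ^ 2)) :=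
        Finset.sum_le_sum fun x _ => mul_le_mul_of_nonneg_left
          (by linarith [exp_le_one_add_add_sq (hY x)]) (hW x)
    _ = ∑ x, W x * (Y x + Y x ^ 2) + 1 := by
        simp only [mul_add (W _) 1, mul_one, Finset.sum_add_distrib, hW1]; ring
    _ ≤ _ := Real.add_one_le_exp _

theorem sum_mul_exp_centered_le {W X : ι → ℝ} (hW : ∀ x, 0 ≤ W x) (hW1 : ∑ x, W x = 1)
    (hX : ∀ x, |X x| ≤ 1) {s : ℝ} (hs0 : 0 ≤ s) (hs : s ≤ 1 / 2) :
    ∑ x, W x * Real.exp (s * (∑ y, W y * X y - X x)) ≤ Real.exp (4 * s ^ 2) := by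
  set m := ∑ y, W y * X y with hm
  have hm1 : |m| ≤ 1 := by
    calc |m| ≤ ∑ y, |W y * X y| := Finset.abs_sum_le_sum_abs _ _
      _ ≤ ∑ y, W y := Finset.sum_le_sum fun y _ => by
          rw [abs_mul, abs_of_nonneg (hW y)]
          exact mul_le_of_le_one_right (hW y) (hX y)
      _ = 1 := hW1
  have hd : ∀ x, |m - X x| ≤ 2 := fun x =>
    (abs_sub _ _).trans (by linarith [hX x])
  refine (sum_mul_exp_le hW hW1 fun x => ?_).trans (Real.exp_le_exp.2 ?_)
  · rw [abs_mul, abs_of_nonneg hs0]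
    nlinarith [hd x]
  · have h0 : ∑ x, W x * (s * (m - X x)) = 0 := by
      have : ∀ x, W x * (s * (m - X x)) = s * m * W x - s * (W x * X x) := fun x => by ring
      simp only [this, Finset.sum_sub_distrib, ← Finset.mul_sum, hW1, ← hm]; ring
    have h1 : ∑ x, W x * (s * (m - X x)) ^ 2 ≤ ∑ x, W x * (4 * s ^ 2) :=
      Finset.sum_le_sum fun x _ => mul_le_mul_of_nonneg_left (by
        rw [mul_pow]
        have : (m - X x) ^ 2 ≤ 2 ^ 2 := sq_le_sq' (abs_le.1 (hd x)).1 (abs_le.1 (hd x)).2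
        nlinarith [sq_nonneg s]) (hW x)
    rw [← Finset.sum_mul, hW1] at h1
    simp only [mul_add, Finset.sum_add_distrib]
    linarith

/-- The exponential moment of the implicitly exploring cost estimates. -/
theorem sum_mul_exp_explore_le {n : ℕ} {k : Fin n → ℕ} [∀ i, NeZero (k i)]
    {w : Fin n → ℝ} (hw : ∀ j, 0 < w j) (hw1 : ∑ j, w j = 1)
    {y : (i : Fin n) × Fin (k i) → ℝ} (hy : ∀ x, y x ∈ Set.Icc (0 : ℝ) 1)
    {lam s : ℝ} (hs : 0 < s) (hsl : 4 * s ≤ lam) (hs1 : s ≤ 1 / 4) (i : Fin n) :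
    ∑ x, w x.1 * (k x.1 : ℝ)⁻¹ * Real.exp (s * (-y x + 2 * lam * (y x / (w x.1 + lam)) +
        if x.1 = i then y x / (w x.1 + lam) else 0)) ≤
      Real.exp (s * ((k i : ℝ)⁻¹ * ∑ a, y ⟨i, a⟩ - ∑ j, w j * ((k j : ℝ)⁻¹ * ∑ a, y ⟨j, a⟩)
        + n * (2 * lam + 12 * s * lam) + 3 * s)) := by
  have hl : 0 < lam := by linarith
  have hc : ∀ j, (k j : ℝ)⁻¹ * ∑ a, y ⟨j, a⟩ ∈ Set.Icc (0 : ℝ) 1 := fun j => by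
    have hk : (0 : ℝ) < k j := by exact_mod_cast Nat.pos_of_ne_zero (NeZero.ne (k j))
    refine ⟨mul_nonneg (by positivity) (Finset.sum_nonneg fun a _ => (hy _).1), ?_⟩
    rw [inv_mul_le_iff₀ hk, mul_one]
    calc ∑ a, y ⟨j, a⟩ ≤ ∑ _a : Fin (k j), (1 : ℝ) := Finset.sum_le_sum fun a _ => (hy _).2
      _ = k j := by simp
  set c : Fin n → ℝ := fun j => (k j : ℝ)⁻¹ * ∑ a, y ⟨j, a⟩ with hcdef
  have hW : ∀ x : (i : Fin n) × Fin (k i), 0 ≤ w x.1 * (k x.1 : ℝ)⁻¹ := fun x =>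
    mul_nonneg (hw _).le (by positivity)
  have hW1 : ∑ x : (i : Fin n) × Fin (k i), w x.1 * (k x.1 : ℝ)⁻¹ = 1 := by
    rw [sum_draw_weight, hw1]
  have hwl : ∀ j, 0 < w j + lam := fun j => by linarith [hw j]
  have hq : ∀ x : (i : Fin n) × Fin (k i), 0 ≤ y x / (w x.1 + lam) ∧
      lam * (y x / (w x.1 + lam)) ≤ 1 := fun x => by
    refine ⟨div_nonneg (hy x).1 (hwl _).le, ?_⟩
    rw [← mul_div_assoc, div_le_one (hwl _)]
    nlinarith [hw x.1, (hy x).2]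
  refine (sum_mul_exp_le hW hW1 fun x => ?_).trans (Real.exp_le_exp.2 ?_)
  · obtain ⟨h0, h1⟩ := hq x
    obtain ⟨hy0, hy1⟩ := hy x
    have h2 : 4 * (s * (y x / (w x.1 + lam))) ≤ 1 := by
      nlinarith [mul_le_mul_of_nonneg_right hsl h0]
    have h3 : 0 ≤ lam * (y x / (w x.1 + lam)) := mul_nonneg hl.le h0
    have h4 : 0 ≤ s * (y x / (w x.1 + lam)) := mul_nonneg hs.le h0
    have h5 : s * (lam * (y x / (w x.1 + lam))) ≤ 1 / 4 := by nlinarith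
    have h6 : s * y x ≤ 1 / 4 := by nlinarith
    have h7 : 0 ≤ s * y x := mul_nonneg hs.le hy0
    have h8 : 0 ≤ s * (lam * (y x / (w x.1 + lam))) := mul_nonneg hs.le h3
    rw [abs_le]
    split_ifs <;> constructor <;> nlinarith
  -- With Y the whole exponent, Y + Y² is at most `φ` times `y` plus 3s². The square is split by (a
  -- + b + c)² ≤ 3(a² + b² + c²); the bound lam·q ≤ 1 makes the middle square linear in `q`, which
  -- gives the constant 12.
  · let φ : Fin n → ℝ := fun j => -s + (2 * lam * s + 12 * s ^ 2 * lam) / (w j + lam) +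
      if j = i then s * (1 + lam / (w j + lam)) / (w j + lam) else 0
    have hpt : ∀ x : (i : Fin n) × Fin (k i),
        s * (-y x + 2 * lam * (y x / (w x.1 + lam)) +
          if x.1 = i then y x / (w x.1 + lam) else 0) +
        (s * (-y x + 2 * lam * (y x / (w x.1 + lam)) +
          if x.1 = i then y x / (w x.1 + lam) else 0)) ^ 2 ≤ φ x.1 * y x + 3 * s ^ 2 := by
      intro x
      obtain ⟨h0, h1⟩ := hq x
      obtain ⟨hy0, hy1⟩ := hy x
      have hwx := hwl x.1
      have hyq : ∀ a, a / (w x.1 + lam) * y x = a * (y x / (w x.1 + lam)) := fun a => by ring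
      simp only [φ]
      set q := y x / (w x.1 + lam) with hqdef
      have hyy : y x ^ 2 ≤ 1 := by nlinarith
      have hqq : (2 * lam * q) ^ 2 ≤ 4 * lam * q := by
        nlinarith [mul_le_mul_of_nonneg_right h1 (mul_nonneg hl.le h0)]
      by_cases hi : x.1 = i
      · simp only [hi, if_true] at hyq ⊢
        rw [← hi] at hyq ⊢
        have hq2 : q ^ 2 ≤ q / (w x.1 + lam) := by
          rw [sq, hqdef, ← mul_div_assoc]
          exact div_le_div_of_nonneg_right (mul_le_of_le_one_right h0 hy1) hwx.le
        have hsq : (-y x + 2 * lam * q + q) ^ 2 ≤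
            3 * (y x ^ 2 + (2 * lam * q) ^ 2 + q ^ 2) := by
          nlinarith [sq_nonneg (y x + 2 * lam * q), sq_nonneg (y x + q),
            sq_nonneg (2 * lam * q - q)]
        have hsl' : 3 * s ^ 2 * (q / (w x.1 + lam)) ≤ s * lam * (q / (w x.1 + lam)) :=
          mul_le_mul_of_nonneg_right (by nlinarith) (div_nonneg h0 hwx.le)
        have e1 : (-s + (2 * lam * s + 12 * s ^ 2 * lam) / (w x.1 + lam) +
            s * (1 + lam / (w x.1 + lam)) / (w x.1 + lam)) * y x
            = -s * y x + (2 * lam * s + 12 * s ^ 2 * lam) * q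
              + (s * q + s * lam * (q / (w x.1 + lam))) := by
          rw [hqdef]; field_simp
        rw [e1]
        nlinarith [mul_le_mul_of_nonneg_left hsq (sq_nonneg s),
          mul_le_mul_of_nonneg_left hqq (sq_nonneg s),
          mul_le_mul_of_nonneg_left hyy (sq_nonneg s),
          mul_le_mul_of_nonneg_left hq2 (sq_nonneg s)]
      · simp only [hi, if_false, add_zero, add_mul, hyq]
        have hsq : (-y x + 2 * lam * q) ^ 2 ≤ 3 * (y x ^ 2 + (2 * lam * q) ^ 2) := by
          nlinarith [sq_nonneg (y x + 2 * lam * q), sq_nonneg (y x), sq_nonneg (2 * lam * q)]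
        nlinarith [mul_le_mul_of_nonneg_left hsq (sq_nonneg s),
          mul_le_mul_of_nonneg_left hqq (sq_nonneg s),
          mul_le_mul_of_nonneg_left hyy (sq_nonneg s)]
    calc _ ≤ ∑ x : (i : Fin n) × Fin (k i),
          w x.1 * (k x.1 : ℝ)⁻¹ * (φ x.1 * y x + 3 * s ^ 2) :=
        Finset.sum_le_sum fun x _ => mul_le_mul_of_nonneg_left (hpt x) (hW x)
      _ = ∑ j, w j * φ j * c j + 3 * s ^ 2 := by
        simp only [mul_add (_ * (k _ : ℝ)⁻¹), Finset.sum_add_distrib]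
        rw [sum_draw w φ y, ← Finset.sum_mul, hW1, one_mul]
      _ ≤ ∑ j, (-s * (w j * c j) + (2 * lam * s + 12 * s ^ 2 * lam) +
            if j = i then s * c j else 0) + 3 * s ^ 2 := by
        gcongr with j
        have hcj := hc j
        change c j ∈ _ at hcj
        obtain ⟨hc0, hc1⟩ := hcj
        have hwj := hw j
        have hwlj := hwl j
        have hA : 0 ≤ 2 * lam * s + 12 * s ^ 2 * lam := by positivity
        have e1 : w j * ((2 * lam * s + 12 * s ^ 2 * lam) / (w j + lam)) * c j ≤
            2 * lam * s + 12 * s ^ 2 * lam := by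
          have : w j / (w j + lam) * c j ≤ 1 :=
            mul_le_one₀ ((div_le_one hwlj).2 (by linarith)) hc0 hc1
          calc _ = (2 * lam * s + 12 * s ^ 2 * lam) * (w j / (w j + lam) * c j) := by ring
            _ ≤ _ := mul_le_of_le_one_right hA this
        -- This is where implicit exploration pays: the downward bias w/(w + lam) of the estimate
        -- absorbs its second moment, since w(w + 2 lam) ≤ (w + lam)².
        have e2 : w j * (s * (1 + lam / (w j + lam)) / (w j + lam)) * c j ≤ s * c j := by
          have : w j * (1 + lam / (w j + lam)) / (w j + lam) ≤ 1 := by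
            rw [div_le_one hwlj, mul_add, mul_one, ← mul_div_assoc, ← le_sub_iff_add_le',
              add_sub_cancel_left, div_le_iff₀ hwlj]
            nlinarith
          calc _ = w j * (1 + lam / (w j + lam)) / (w j + lam) * (s * c j) := by ring
            _ ≤ _ := mul_le_of_le_one_left (mul_nonneg hs.le hc0) this
        simp only [φ]
        split_ifs <;> nlinarith
      _ = _ := by
        simp only [Finset.sum_add_distrib, ← Finset.mul_sum, Finset.sum_ite_eq',
          Finset.mem_univ, if_true, Finset.sum_const, Finset.card_univ, Fintype.card_fin,
          nsmul_eq_mul, hcdef]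
        ring

end Moments

/-! ### The potential of exponential weights. -/

section LogSumExp

variable {n : ℕ}

/-- The potential of the exponential weights. -/
noncomputable def logSumExp (κ : ℝ) (c : Fin n → ℝ) : ℝ := Real.log (∑ j, Real.exp (-κ * c j)) / κ

theorem neg_le_logSumExp [NeZero n] {κ : ℝ} (hκ : 0 < κ) (c : Fin n → ℝ) (i : Fin n) :
    -c i ≤ logSumExp κ c := by
  rw [logSumExp, le_div_iff₀ hκ, Real.le_log_iff_exp_le
    (Finset.sum_pos (fun j _ => Real.exp_pos _) Finset.univ_nonempty)]
  have := Finset.single_le_sum (f := fun j => Real.exp (-κ * c j))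
    (fun j _ => (Real.exp_pos _).le) (Finset.mem_univ i)
  rw [show -c i * κ = -κ * c i by ring]
  exact this

theorem logSumExp_zero (κ : ℝ) : logSumExp κ (0 : Fin n → ℝ) = Real.log n / κ := by
  simp [logSumExp]

/-- With κ = 2 lam the second-order term (κ/2)·w·q² is at most lam·q, because w·q ≤ 1. Another lam·q
is the exploration bias in y = (w + lam)·q. -/
theorem logSumExp_add_single_le [NeZero n] {lam : ℝ} (hl : 0 < lam) (c : Fin n → ℝ)
    (j : Fin n) {y : ℝ} (hy : y ∈ Set.Icc (0 : ℝ) 1) :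
    logSumExp (2 * lam) (c + Pi.single j (y / (hedgeWeight (2 * lam) c j + lam))) ≤
      logSumExp (2 * lam) c - y + 2 * lam * (y / (hedgeWeight (2 * lam) c j + lam)) := by
  set w := hedgeWeight (2 * lam) c with hw
  have hwj : 0 < w j := hedgeWeight_pos _ _ _
  have hwl : 0 < w j + lam := by linarith
  set q := y / (w j + lam) with hq
  have hq0 : 0 ≤ q := div_nonneg hy.1 hwl.le
  have hyq : y = w j * q + lam * q := by rw [hq]; field_simp
  set S := ∑ i, Real.exp (-(2 * lam) * c i) with hS
  have hSpos : 0 < S := Finset.sum_pos (fun j _ => Real.exp_pos _) Finset.univ_nonempty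
  have hsum : ∑ i, Real.exp (-(2 * lam) * (c + Pi.single j q : Fin n → ℝ) i) =
      S * (1 + w j * (Real.exp (-(2 * lam * q)) - 1)) := by
    have h1 : ∀ i, Real.exp (-(2 * lam) * (c + Pi.single j q : Fin n → ℝ) i) =
        Real.exp (-(2 * lam) * c i) +
          if i = j then Real.exp (-(2 * lam) * c i) * (Real.exp (-(2 * lam * q)) - 1) else 0 := by
      intro i
      by_cases h : i = j
      · subst h
        simp only [Pi.add_apply, Pi.single_eq_same, if_true]
        rw [mul_add, Real.exp_add]
        ring_nf
      · simp [h]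
    have h2 : S * w j = Real.exp (-(2 * lam) * c j) := by
      rw [hw, hedgeWeight, ← hS]; field_simp
    simp only [h1, Finset.sum_add_distrib, Finset.sum_ite_eq', Finset.mem_univ, if_true]
    rw [← h2]; ring
  have hexp := exp_neg_le_quadratic (mul_nonneg (mul_nonneg two_pos.le hl.le) hq0)
  have hlog : Real.log (1 + w j * (Real.exp (-(2 * lam * q)) - 1)) ≤
      2 * lam * (-y + 2 * lam * q) := by
    have hwj1 : w j ≤ 1 := by
      rw [← sum_hedgeWeight (2 * lam) c]
      exact Finset.single_le_sum (fun i _ => (hedgeWeight_pos _ c i).le) (Finset.mem_univ j)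
    have hpos : 0 < 1 + w j * (Real.exp (-(2 * lam * q)) - 1) := by
      have := Real.exp_pos (-(2 * lam * q)); nlinarith
    have h1 := Real.log_le_sub_one_of_pos hpos
    have h2 : w j * q ≤ 1 := by have := mul_nonneg hl.le hq0; linarith [hy.2]
    have h3 : w j * (Real.exp (-(2 * lam * q)) - 1) ≤
        w j * (-(2 * lam * q) + (2 * lam * q) ^ 2 / 2) :=
      mul_le_mul_of_nonneg_left (by linarith) hwj.le
    have h4 : w j * q * (lam * lam * q) ≤ lam * lam * q :=
      mul_le_of_le_one_left (by positivity) h2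
    rw [hyq]
    nlinarith
  rw [logSumExp, hsum, Real.log_mul hSpos.ne' (by
    have := Real.exp_pos (-(2 * lam * q))
    have hwj1 : w j ≤ 1 := by
      rw [← sum_hedgeWeight (2 * lam) c]
      exact Finset.single_le_sum (fun i _ => (hedgeWeight_pos _ c i).le) (Finset.mem_univ j)
    nlinarith), add_div, logSumExp, ← hS]
  have : Real.log (1 + w j * (Real.exp (-(2 * lam * q)) - 1)) / (2 * lam) ≤ -y + 2 * lam * q := by
    rw [div_le_iff₀ (by linarith)]; linarith
  linarith

end LogSumExp

/-! ### Markov chains with an accumulated functional. -/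

section Tracked

variable {σ : Type*}

/-- The law of a Markov chain together with the accumulated value of `f` along its path. -/
noncomputable def tracked (K : σ → PMF σ) (f : σ → ℝ) (s₀ : σ) : ℕ → PMF (σ × ℝ)
  | 0 => PMF.pure (s₀, 0)
  -- `f` is evaluated before the transition, so t steps accumulate the first t states, exactly those
  -- averaged by the output.
  | t + 1 => (tracked K f s₀ t).bind fun p => (K p.1).map fun s => (s, p.2 + f p.1)

theorem tracked_induction {K : σ → PMF σ} {f : σ → ℝ} {s₀ : σ} {P : ℕ → σ → ℝ → Prop}
    (h0 : P 0 s₀ 0)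
    (hstep : ∀ t s a s', P t s a → s' ∈ (K s).support → P (t + 1) s' (a + f s)) :
    ∀ t, ∀ p ∈ (tracked K f s₀ t).support, P t p.1 p.2
  | 0, p, hp => by
    rw [tracked, PMF.mem_support_pure_iff] at hp
    subst hp; exact h0
  | t + 1, p, hp => by
    rw [tracked, PMF.mem_support_bind_iff] at hp
    obtain ⟨q, hq, hp⟩ := hp
    rw [PMF.mem_support_map_iff] at hp
    obtain ⟨s', hs', rfl⟩ := hp
    exact hstep t q.1 q.2 s' (tracked_induction h0 hstep t q hq) hs'

/-- A multiplicative supermartingale bound along a chain. -/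
theorem expect_tracked_exp_le {K : σ → PMF σ} {f Ψ : σ → ℝ} {s₀ : σ} {β b : ℝ} {P : σ → Prop}
    (h0 : P s₀) (hP : ∀ s s', P s → s' ∈ (K s).support → P s')
    (hstep : ∀ s, P s → (expect (K s) fun s' => ENNReal.ofReal (Real.exp (β * Ψ s'))) ≤
      ENNReal.ofReal (Real.exp (β * (b - f s + Ψ s)))) (t : ℕ) :
    (expect (tracked K f s₀ t) fun p => ENNReal.ofReal (Real.exp (β * (p.2 + Ψ p.1)))) ≤
      ENNReal.ofReal (Real.exp (β * (t * b + Ψ s₀))) := by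
  induction t with
  | zero => simp [tracked, expect_pure]
  | succ t ih =>
    have hsupp := tracked_induction (K := K) (f := f) (P := fun _ s _ => P s) h0
      (fun _ s _ s' hs hs' => hP s s' hs hs') t
    rw [tracked, expect_bind]
    calc _ ≤ expect (tracked K f s₀ t) fun p =>
          ENNReal.ofReal (Real.exp (β * (p.2 + Ψ p.1))) * ENNReal.ofReal (Real.exp (β * b)) := by
          refine expect_mono fun p hp => ?_
          rw [expect_map]
          have h := mul_le_mul_left (hstep p.1 (hsupp p hp))
            (ENNReal.ofReal (Real.exp (β * (p.2 + f p.1))))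
          rw [← expect_mul_const] at h
          simp only [← ENNReal.ofReal_mul (Real.exp_pos _).le, ← Real.exp_add] at h ⊢
          have e1 : ∀ s, β * (p.2 + f p.1 + Ψ s) = β * Ψ s + β * (p.2 + f p.1) := fun s => by ring
          have e2 : β * (p.2 + Ψ p.1) + β * b =
            β * (b - f p.1 + Ψ p.1) + β * (p.2 + f p.1) := by ring
          simp only [e1, e2]
          exact h
      _ ≤ _ := by
        rw [expect_mul_const]
        refine (mul_le_mul_left ih _).trans_eq ?_
        rw [← ENNReal.ofReal_mul (Real.exp_pos _).le, ← Real.exp_add]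
        push_cast
        ring_nf

end Tracked

/-! ### Risks, worst-case risk and the optimum. -/

section WorstRisk

variable {E Z : Type*} {n : ℕ} {loss : E → Z → ℝ}

theorem risk_le_worstRisk (D : Fin n → PMF Z) (θ : E) (i : Fin n) :
    risk loss (D i) θ ≤ worstRisk loss D θ :=
  le_ciSup (f := fun i => risk loss (D i) θ) (Set.finite_range _).bddAbove i

theorem worstRisk_le [NeZero n] (D : Fin n → PMF Z) {θ : E} {a : ℝ}
    (h : ∀ i, risk loss (D i) θ ≤ a) : worstRisk loss D θ ≤ a :=
  ciSup_le h

theorem exists_worstRisk_lt {Θ : Set E} (hne : Θ.Nonempty) (D : Fin n → PMF Z) {a : ℝ}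
    (ha : 0 < a) :
    ∃ u ∈ Θ, worstRisk loss D u < opt Θ loss D + a := by
  have : Nonempty Θ := hne.to_subtype
  obtain ⟨u, hu⟩ := exists_lt_of_ciInf_lt (show opt Θ loss D < opt Θ loss D + a by linarith)
  exact ⟨u, u.2, hu⟩

end WorstRisk

section Risk

variable {E : Type*} [NormedAddCommGroup E] [NormedSpace ℝ E] {Z : Type*} {n : ℕ}
  {k : Fin n → ℕ} [∀ i, NeZero (k i)] {Θ : Set E} {loss : E → Z → ℝ}
  {grad : E → Z → (E →L[ℝ] ℝ)}

theorem risk_empirical_mem_Icc (hl : IsSmoothConvexLoss Θ loss grad) {m : ℕ} [NeZero m]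
    (b : Fin m → Z) {θ : E} (hθ : θ ∈ Θ) : risk loss (empirical b) θ ∈ Set.Icc (0 : ℝ) 1 := by
  have hk : (0 : ℝ) < m := by exact_mod_cast Nat.pos_of_ne_zero (NeZero.ne m)
  rw [risk_empirical]
  refine ⟨mul_nonneg (by positivity) (Finset.sum_nonneg fun a _ => (hl.mem_Icc θ hθ _).1), ?_⟩
  rw [inv_mul_le_iff₀ hk, mul_one]
  calc ∑ a, loss θ (b a) ≤ ∑ _a : Fin m, (1 : ℝ) :=
        Finset.sum_le_sum fun a _ => (hl.mem_Icc θ hθ _).2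
    _ = m := by simp

theorem convexOn_risk_empirical (hl : IsSmoothConvexLoss Θ loss grad) (hΘ : Convex ℝ Θ) {m : ℕ}
    [NeZero m] (b : Fin m → Z) : ConvexOn ℝ Θ (risk loss (empirical b)) := by
  refine ⟨hΘ, fun x hx y hy p q hp hq hpq => ?_⟩
  simp only [risk_empirical, smul_eq_mul]
  calc (m : ℝ)⁻¹ * ∑ a, loss (p • x + q • y) (b a)
      ≤ (m : ℝ)⁻¹ * ∑ a, (p * loss x (b a) + q * loss y (b a)) := by
        gcongr with a
        exact (hl.convexOn (b a)).2 hx hy hp hq hpq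
    _ = _ := by rw [Finset.sum_add_distrib, ← Finset.mul_sum, ← Finset.mul_sum]; ring

theorem worstRisk_nonneg (hl : IsSmoothConvexLoss Θ loss grad)
    (B : (i : Fin n) → Fin (k i) → Z) {θ : E} (hθ : θ ∈ Θ) :
    0 ≤ worstRisk loss (fun i => empirical (B i)) θ :=
  Real.iSup_nonneg fun i => (risk_empirical_mem_Icc hl (B i) hθ).1

theorem opt_nonneg (hl : IsSmoothConvexLoss Θ loss grad) (B : (i : Fin n) → Fin (k i) → Z) :
    0 ≤ opt Θ loss (fun i => empirical (B i)) :=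
  Real.iInf_nonneg fun θ => worstRisk_nonneg hl B θ.2

theorem isEpsOptimal_of_one_le [NeZero n] (hl : IsSmoothConvexLoss Θ loss grad)
    (B : (i : Fin n) → Fin (k i) → Z) {ε : ℝ} (hε : 1 ≤ ε) {θ : E} (hθ : θ ∈ Θ) :
    IsEpsOptimal Θ loss (fun i => empirical (B i)) ε θ := by
  have h1 := opt_nonneg hl B
  exact ⟨hθ, worstRisk_le _ fun i => by linarith [(risk_empirical_mem_Icc hl (B i) hθ).2]⟩

end Risk

/-! ### Trajectories, averaging, and the one-step change of the potential. -/

section Analysis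

variable {E : Type*} [NormedAddCommGroup E] [NormedSpace ℝ E]
  {Z : Type*} {n : ℕ} [NeZero n] {Θ : Set E} {ω : E → ℝ} {ω' : E → (E →L[ℝ] ℝ)}
  {loss : E → Z → ℝ} {grad : E → Z → (E →L[ℝ] ℝ)} {θc : E}

theorem tracked_map_fst (D : Fin n → PMF Z) (η κ lam : ℝ) (f : AlgState E n → ℝ) (t : ℕ) :
    (tracked (iteration Θ ω ω' loss grad D η κ lam) f
      { point := θc, cost := 0, total := 0 } t).map Prod.fst =
      run Θ ω ω' θc loss grad D η κ lam t := by
  induction t with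
  | zero => simp [tracked, run, PMF.pure_map]
  | succ t ih =>
    rw [tracked, run, ← ih, PMF.map_bind, PMF.bind_map]
    congr 1
    funext p
    rw [PMF.map_comp]
    exact PMF.map_id _

theorem exists_of_mem_support_iteration {D : Fin n → PMF Z} {η κ lam : ℝ} {s s' : AlgState E n}
    (h : s' ∈ (iteration Θ ω ω' loss grad D η κ lam s).support) :
    (∃ z, s'.point = mirrorStep Θ ω ω' η s.point (grad s.point z)) ∧
      s'.total = s.total + s.point := by
  simp only [iteration, PMF.mem_support_bind_iff, PMF.mem_support_pure_iff] at h
  obtain ⟨i, -, z, -, j, -, z', -, rfl⟩ := h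
  exact ⟨⟨z, rfl⟩, rfl⟩

theorem point_mem_of_mem_support_iteration (hΘ : IsCompact Θ) (hω : IsDGF Θ ω ω')
    {D : Fin n → PMF Z} {η κ lam : ℝ} {s s' : AlgState E n}
    (h : s' ∈ (iteration Θ ω ω' loss grad D η κ lam s).support) :
    s'.point ∈ subdiffDomain Θ ω := by
  obtain ⟨⟨z, hz⟩, -⟩ := exists_of_mem_support_iteration h
  rw [hz]
  exact mirrorStep_mem_subdiffDomain hΘ hω _ _ _

theorem exists_path_of_mem_support_tracked (hΘ : IsCompact Θ) (hω : IsDGF Θ ω ω')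
    (hθc : θc ∈ subdiffDomain Θ ω) {D : Fin n → PMF Z} {η κ lam : ℝ} {f : E → ℝ} (t : ℕ) :
    ∀ p ∈ (tracked (iteration Θ ω ω' loss grad D η κ lam) (fun s => f s.point)
      { point := θc, cost := 0, total := 0 } t).support,
      p.1.point ∈ subdiffDomain Θ ω ∧ ∃ x : ℕ → E, (∀ τ, x τ ∈ Θ) ∧
        p.1.total = ∑ τ ∈ Finset.range t, x τ ∧ p.2 = ∑ τ ∈ Finset.range t, f (x τ) := by
  refine tracked_induction (P := fun t (s : AlgState E n) a => s.point ∈ subdiffDomain Θ ω ∧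
    ∃ x : ℕ → E, (∀ τ, x τ ∈ Θ) ∧ s.total = ∑ τ ∈ Finset.range t, x τ ∧
      a = ∑ τ ∈ Finset.range t, f (x τ)) ⟨hθc, fun _ => θc, fun _ => hθc.1, by simp, by simp⟩ ?_ t
  rintro t s a s' ⟨hs, x, hx, htot, ha⟩ hs'
  -- The path is defined on all of ℕ; overwriting it at time t leaves the earlier terms unchanged.
  refine ⟨point_mem_of_mem_support_iteration hΘ hω hs', Function.update x t s.point, ?_, ?_, ?_⟩
  · intro τ
    by_cases h : τ = t
    · subst h; simpa using hs.1
    · simpa [h] using hx τ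
  · rw [(exists_of_mem_support_iteration hs').2, Finset.sum_range_succ, htot]
    congr 1
    · exact Finset.sum_congr rfl fun τ hτ => by
        rw [Function.update_of_ne (Finset.mem_range.1 hτ).ne]
    · simp
  · rw [Finset.sum_range_succ, ha]
    congr 1
    · exact Finset.sum_congr rfl fun τ hτ => by
        rw [Function.update_of_ne (Finset.mem_range.1 hτ).ne]
    · simp

theorem average_mem (hconv : Convex ℝ Θ) {T : ℕ} (hT : 0 < T) {x : ℕ → E}
    (hx : ∀ τ, x τ ∈ Θ) : (T : ℝ)⁻¹ • ∑ τ ∈ Finset.range T, x τ ∈ Θ := by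
  rw [Finset.smul_sum]
  have : (T : ℝ) ≠ 0 := by positivity
  exact hconv.sum_mem (fun _ _ => by positivity) (by simp [this]) (fun τ _ => hx τ)

theorem map_average_le {f : E → ℝ} (hf : ConvexOn ℝ Θ f) {T : ℕ} (hT : 0 < T) {x : ℕ → E}
    (hx : ∀ τ, x τ ∈ Θ) :
    T * f ((T : ℝ)⁻¹ • ∑ τ ∈ Finset.range T, x τ) ≤ ∑ τ ∈ Finset.range T, f (x τ) := by
  have h0 : (0 : ℝ) < T := by positivity
  rw [Finset.smul_sum, ← le_inv_mul_iff₀ h0, Finset.mul_sum]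
  have := hf.map_sum_le (t := Finset.range T) (w := fun _ => (T : ℝ)⁻¹) (p := x)
    (fun _ _ => by positivity) (by simp [h0.ne']) (fun τ _ => hx τ)
  simpa using this

/-- The potential of a state: the learner's divergence to `u`, the auditor's log-sum-exp and
the estimated cost of group `i`. -/
noncomputable def potential (ω : E → ℝ) (ω' : E → (E →L[ℝ] ℝ)) (η κ : ℝ) (u : E) (i : Fin n)
    (s : AlgState E n) : ℝ :=
  bregman ω ω' s.point u / η + logSumExp κ s.cost + s.cost i

theorem potential_nonneg (hω : IsDGF Θ ω ω') {η κ : ℝ} (hη : 0 < η) (hκ : 0 < κ) {u : E}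
    (hu : u ∈ Θ) (i : Fin n) {s : AlgState E n} (hs : s.point ∈ subdiffDomain Θ ω) :
    0 ≤ potential ω ω' η κ u i s := by
  have h1 := div_nonneg (bregman_nonneg hω hs hu) hη.le
  have h2 := neg_le_logSumExp hκ s.cost i
  unfold potential; linarith

theorem potential_step_le [FiniteDimensional ℝ E] (hconv : Convex ℝ Θ)
    (hΘ : IsCompact Θ) (hω : IsDGF Θ ω ω') (hl : IsSmoothConvexLoss Θ loss grad) {η lam : ℝ} (hη : 0 < η)
    (hlam : 0 < lam) {u : E} (hu : u ∈ Θ) (i j : Fin n) (z z' : Z) {s : AlgState E n}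
    (hs : s.point ∈ subdiffDomain Θ ω) :
    potential ω ω' η (2 * lam) u i
      { point := mirrorStep Θ ω ω' η s.point (grad s.point z)
        cost := s.cost +
          Pi.single j ((1 - loss s.point z') / (hedgeWeight (2 * lam) s.cost j + lam))
        total := s.total + s.point } ≤
      potential ω ω' η (2 * lam) u i s + η / 2 - (loss s.point z - loss u z) +
      (-(1 - loss s.point z') +
        2 * lam * ((1 - loss s.point z') / (hedgeWeight (2 * lam) s.cost j + lam)) +
        if j = i then (1 - loss s.point z') / (hedgeWeight (2 * lam) s.cost j + lam) else 0) := by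
  have h1 := mirrorStep_regret hconv hΘ hω hη hs hu (hl.norm_le z _ hs.1)
  have h2 := add_gradient_le_of_convexOn (hl.convexOn z) hs.1 hu (hl.hasGradient z _ hs.1)
  have hy := hl.mem_Icc _ hs.1 z'
  have h3 := logSumExp_add_single_le hlam s.cost j (y := 1 - loss s.point z')
    ⟨by linarith [hy.2], by linarith [hy.1]⟩
  have h4 : grad s.point z (u - s.point) = - grad s.point z (s.point - u) := by
    rw [← map_neg, neg_sub]
  have h5 : (s.cost + Pi.single j ((1 - loss s.point z') /
      (hedgeWeight (2 * lam) s.cost j + lam)) : Fin n → ℝ) i = s.cost i +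
      if j = i then (1 - loss s.point z') / (hedgeWeight (2 * lam) s.cost j + lam) else 0 := by
    simp [Pi.single_apply, eq_comm]
  simp only [potential, h5]
  rw [sub_div] at h1
  linarith

theorem expect_iteration {k : Fin n → ℕ} [∀ i, NeZero (k i)] (B : (i : Fin n) → Fin (k i) → Z)
    (η κ lam : ℝ) (s : AlgState E n) (F : AlgState E n → ℝ≥0∞) :
    expect (iteration Θ ω ω' loss grad (fun i => empirical (B i)) η κ lam s) F =
      ∑ x : (i : Fin n) × Fin (k i), ENNReal.ofReal (hedgeWeight κ s.cost x.1 * (k x.1 : ℝ)⁻¹) *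
      ∑ y : (i : Fin n) × Fin (k i), ENNReal.ofReal (hedgeWeight κ s.cost y.1 * (k y.1 : ℝ)⁻¹) *
        F { point := mirrorStep Θ ω ω' η s.point (grad s.point (B x.1 x.2))
            cost := s.cost + Pi.single y.1
              ((1 - loss s.point (B y.1 y.2)) / (hedgeWeight κ s.cost y.1 + lam))
            total := s.total + s.point } := by
  simp only [iteration, expect_bind, expect_pure, expect_draw]

end Analysis

/-! ### The supermartingale and the tail bound for one group. -/

section Supermartingale

variable {E : Type*} [NormedAddCommGroup E] [NormedSpace ℝ E]
  {Z : Type*} {n : ℕ} [NeZero n] {k : Fin n → ℕ} [∀ i, NeZero (k i)]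
  {Θ : Set E} {ω : E → ℝ} {ω' : E → (E →L[ℝ] ℝ)}
  {loss : E → Z → ℝ} {grad : E → Z → (E →L[ℝ] ℝ)} {θc : E}

/-- The two draws are independent, so the exponential moment factors into a learner's and an
auditor's moment. Their second-order terms 4β and 3β make up the 7β. -/
theorem expect_iteration_exp_potential_le [FiniteDimensional ℝ E] (hconv : Convex ℝ Θ)
    (hΘ : IsCompact Θ) (hω : IsDGF Θ ω ω') (hl : IsSmoothConvexLoss Θ loss grad)
    (B : (i : Fin n) → Fin (k i) → Z) {η lam β : ℝ} (hη : 0 < η)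
    (hβ : 0 < β) (hβl : 4 * β ≤ lam) (hβ1 : β ≤ 1 / 4) {u : E} (hu : u ∈ Θ) (i : Fin n)
    {s : AlgState E n} (hs : s.point ∈ subdiffDomain Θ ω) :
    (expect (iteration Θ ω ω' loss grad (fun i => empirical (B i)) η (2 * lam) lam s) fun s' =>
        ENNReal.ofReal (Real.exp (β * potential ω ω' η (2 * lam) u i s'))) ≤
      ENNReal.ofReal (Real.exp (β * ((worstRisk loss (fun i => empirical (B i)) u + η / 2 +
        n * (2 * lam + 12 * β * lam) + 7 * β) - risk loss (empirical (B i)) s.point +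
        potential ω ω' η (2 * lam) u i s))) := by
  have hlam : 0 < lam := by linarith
  set w := hedgeWeight (2 * lam) s.cost with hw
  have hwpos : ∀ j, 0 < w j := hedgeWeight_pos _ _
  have hw1 : ∑ j, w j = 1 := sum_hedgeWeight _ _
  let W : (i : Fin n) × Fin (k i) → ℝ := fun x => w x.1 * (k x.1 : ℝ)⁻¹
  have hW : ∀ x, 0 ≤ W x := fun x => mul_nonneg (hwpos _).le (by positivity)
  have hW1 : ∑ x, W x = 1 := by simp only [W]; rw [sum_draw_weight, hw1]
  let X : (i : Fin n) × Fin (k i) → ℝ := fun x =>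
    loss s.point (B x.1 x.2) - loss u (B x.1 x.2)
  let c : (i : Fin n) × Fin (k i) → ℝ := fun x => 1 - loss s.point (B x.1 x.2)
  let Y : (i : Fin n) × Fin (k i) → ℝ := fun x => -c x + 2 * lam * (c x / (w x.1 + lam)) +
    if x.1 = i then c x / (w x.1 + lam) else 0
  have hX : ∀ x, |X x| ≤ 1 := fun x => by
    obtain ⟨h1, h2⟩ := hl.mem_Icc _ hs.1 (B x.1 x.2)
    obtain ⟨h3, h4⟩ := hl.mem_Icc _ hu (B x.1 x.2)
    exact abs_le.2 ⟨by simp only [X]; linarith, by simp only [X]; linarith⟩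
  have hc : ∀ x, c x ∈ Set.Icc (0 : ℝ) 1 := fun x => by
    obtain ⟨h1, h2⟩ := hl.mem_Icc _ hs.1 (B x.1 x.2)
    exact ⟨by simp only [c]; linarith, by simp only [c]; linarith⟩
  have hcr : ∀ j, (k j : ℝ)⁻¹ * ∑ a, c ⟨j, a⟩ = 1 - risk loss (empirical (B j)) s.point := by
    intro j
    have : (k j : ℝ) ≠ 0 := by exact_mod_cast NeZero.ne (k j)
    simp [c, risk_empirical, mul_sub, this]
  have hm : ∑ x, W x * X x = ∑ j, w j * risk loss (empirical (B j)) s.point -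
      ∑ j, w j * risk loss (empirical (B j)) u := by
    have h := sum_draw w (fun _ => 1) X
    simp only [one_mul, mul_one] at h
    refine h.trans ?_
    simp only [X, risk_empirical, mul_sub, Finset.sum_sub_distrib]
  set m := ∑ x, W x * X x with hmdef
  have hlearn := sum_mul_exp_centered_le hW hW1 hX hβ.le (by linarith)
  rw [← hmdef] at hlearn
  have hexplore : ∑ x, W x * Real.exp (β * Y x) ≤ _ :=
    sum_mul_exp_explore_le hwpos hw1 hc hβ hβl hβ1 i
  have hwc : ∑ j, w j * (1 - risk loss (empirical (B j)) s.point) =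
      1 - ∑ j, w j * risk loss (empirical (B j)) s.point := by
    simp only [mul_sub, mul_one, Finset.sum_sub_distrib, hw1]
  simp only [hcr, hwc] at hexplore
  have hρ : ∑ j, w j * risk loss (empirical (B j)) u ≤
      worstRisk loss (fun i => empirical (B i)) u := by
    calc _ ≤ ∑ j, w j * worstRisk loss (fun i => empirical (B i)) u := by
          gcongr with j
          · exact (hwpos j).le
          · exact risk_le_worstRisk (fun i => empirical (B i)) u j
      _ = _ := by rw [← Finset.sum_mul, hw1, one_mul]
  set P := potential ω ω' η (2 * lam) u i s with hP
  rw [expect_iteration]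
  calc _ ≤ ∑ x, ENNReal.ofReal (W x) * ∑ y, ENNReal.ofReal (W y) *
        ENNReal.ofReal (Real.exp (β * (P + η / 2 - X x + Y y))) := by
        gcongr with x _ y _
        exact potential_step_le hconv hΘ hω hl hη hlam hu i y.1 (B x.1 x.2) (B y.1 y.2) hs
    _ = ENNReal.ofReal (∑ x, W x * ∑ y, W y * Real.exp (β * (P + η / 2 - X x + Y y))) := by
        rw [ENNReal.ofReal_sum_of_nonneg fun x _ => mul_nonneg (hW x)
          (Finset.sum_nonneg fun y _ => mul_nonneg (hW y) (Real.exp_pos _).le)]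
        refine Finset.sum_congr rfl fun x _ => ?_
        rw [ENNReal.ofReal_mul (hW x), ENNReal.ofReal_sum_of_nonneg fun y _ =>
          mul_nonneg (hW y) (Real.exp_pos _).le]
        simp only [ENNReal.ofReal_mul (hW _)]
    _ ≤ _ := ENNReal.ofReal_le_ofReal ?_
  calc _ = Real.exp (β * (P + η / 2 - m)) * ((∑ x, W x * Real.exp (β * (m - X x))) *
        ∑ y, W y * Real.exp (β * Y y)) := by
        rw [Finset.sum_mul_sum, Finset.mul_sum]
        refine Finset.sum_congr rfl fun x _ => ?_
        rw [Finset.mul_sum, Finset.mul_sum]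
        refine Finset.sum_congr rfl fun y _ => ?_
        have : β * (P + η / 2 - X x + Y y) =
          β * (P + η / 2 - m) + β * (m - X x) + β * Y y := by ring
        rw [this, Real.exp_add, Real.exp_add]
        ring
    _ ≤ Real.exp (β * (P + η / 2 - m)) * (_ * _) := by
        refine mul_le_mul_of_nonneg_left (mul_le_mul hlearn hexplore ?_ (Real.exp_pos _).le)
          (Real.exp_pos _).le
        exact Finset.sum_nonneg fun y _ => mul_nonneg (hW y) (Real.exp_pos _).le
    _ ≤ _ := by
        rw [← Real.exp_add, ← Real.exp_add, hm]
        refine Real.exp_le_exp.2 ?_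
        -- The `w`-average risk at the current point cancels here; that of `u` is bounded by its
        -- worst risk.
        nlinarith [mul_le_mul_of_nonneg_left hρ hβ.le]

/-- The probability that the output is bad for a fixed group. -/
theorem output_risk_tail [FiniteDimensional ℝ E] (hconv : Convex ℝ Θ)
    (hΘ : IsCompact Θ) (hω : IsDGF Θ ω ω') (hθc : θc ∈ subdiffDomain Θ ω) (hl : IsSmoothConvexLoss Θ loss grad)
    (B : (i : Fin n) → Fin (k i) → Z) {η lam β : ℝ} (hη : 0 < η)
    (hβ : 0 < β) (hβl : 4 * β ≤ lam) (hβ1 : β ≤ 1 / 4) {u : E} (hu : u ∈ Θ) (i : Fin n)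
    {T : ℕ} (hT : 0 < T) {a : ℝ} :
    (output Θ ω ω' θc loss grad (fun i => empirical (B i)) η (2 * lam) lam T).toOuterMeasure
      {θ | a < risk loss (empirical (B i)) θ} ≤
    ENNReal.ofReal (Real.exp (β * (T * (worstRisk loss (fun i => empirical (B i)) u + η / 2 +
      n * (2 * lam + 12 * β * lam) + 7 * β - a) + bregmanRadius Θ ω ω' θc / η +
      Real.log n / (2 * lam)))) := by
  have hlam : 0 < lam := by linarith
  set D : Fin n → PMF Z := fun i => empirical (B i) with hD
  set f : E → ℝ := risk loss (empirical (B i)) with hf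
  set b := worstRisk loss D u + η / 2 + n * (2 * lam + 12 * β * lam) + 7 * β with hb
  have key := expect_tracked_exp_le
    (K := iteration Θ ω ω' loss grad D η (2 * lam) lam) (f := fun s => f s.point)
    (Ψ := potential ω ω' η (2 * lam) u i) (s₀ := { point := θc, cost := 0, total := 0 })
    (β := β) (b := b) (P := fun s => s.point ∈ subdiffDomain Θ ω) hθc
    (fun s s' _ hs' => point_mem_of_mem_support_iteration hΘ hω hs')
    (fun s hs => expect_iteration_exp_potential_le hconv hΘ hω hl B hη hβ hβl hβ1 hu i hs) T
  have hpath := exists_path_of_mem_support_tracked (loss := loss) (grad := grad) (D := D)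
    (η := η) (κ := 2 * lam) (lam := lam) (f := f) hΘ hω hθc T
  rw [output, ← tracked_map_fst (f := fun s => f s.point), PMF.map_comp,
    PMF.toOuterMeasure_map_apply]
  -- Chernoff bound: on the bad event convexity makes the accumulated risk at least T·a, and the
  -- potential is nonnegative.
  calc _ ≤ expect _ fun p : AlgState E n × ℝ => ENNReal.ofReal (Real.exp (β *
          (p.2 + potential ω ω' η (2 * lam) u i p.1))) * ENNReal.ofReal (Real.exp (-(β * (T * a)))) := by
        refine toOuterMeasure_le_expect fun p hp hbad => ?_
        obtain ⟨hpt, x, hx, htot, hacc⟩ := hpath p hp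
        have hbad' : a < f ((T : ℝ)⁻¹ • p.1.total) := hbad
        rw [htot] at hbad'
        have h1 := map_average_le (convexOn_risk_empirical hl hconv (B i)) hT hx
        rw [← hf, ← hacc] at h1
        have h2 := potential_nonneg hω hη (mul_pos two_pos hlam) hu i hpt
        have hT' : (0 : ℝ) < T := by exact_mod_cast hT
        rw [← ENNReal.ofReal_mul (Real.exp_pos _).le, ← Real.exp_add, ← ENNReal.ofReal_one]
        refine ENNReal.ofReal_le_ofReal (Real.one_le_exp ?_)
        have h3 : T * a ≤ p.2 := by nlinarith
        nlinarith [mul_nonneg hβ.le (by linarith : 0 ≤ p.2 + potential ω ω' η (2 * lam) u i p.1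
          - T * a)]
    _ ≤ _ := by
        rw [expect_mul_const]
        refine (mul_le_mul_left key _).trans ?_
        rw [← ENNReal.ofReal_mul (Real.exp_pos _).le, ← Real.exp_add]
        refine ENNReal.ofReal_le_ofReal (Real.exp_le_exp.2 ?_)
        have h0 : potential ω ω' η (2 * lam) u i { point := θc, cost := 0, total := 0 } ≤
            bregmanRadius Θ ω ω' θc / η + Real.log n / (2 * lam) := by
          have := div_le_div_of_nonneg_right (bregman_le_bregmanRadius hΘ hω θc hu) hη.le
          simp only [potential, logSumExp_zero, Pi.zero_apply]
          linarith
        nlinarith [mul_le_mul_of_nonneg_left h0 hβ.le]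

theorem output_mem_of_mem_support (hconv : Convex ℝ Θ) (hΘ : IsCompact Θ)
    (hω : IsDGF Θ ω ω') (hθc : θc ∈ subdiffDomain Θ ω) {D : Fin n → PMF Z} {η κ lam : ℝ}
    {T : ℕ} (hT : 0 < T) {θ : E}
    (hθ : θ ∈ (output Θ ω ω' θc loss grad D η κ lam T).support) : θ ∈ Θ := by
  rw [output, ← tracked_map_fst (f := fun _ => 0), PMF.map_comp, PMF.mem_support_map_iff] at hθ
  obtain ⟨p, hp, rfl⟩ := hθ
  obtain ⟨-, x, hx, htot, -⟩ :=
    exists_path_of_mem_support_tracked (f := fun _ => 0) hΘ hω hθc T p hp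
  simp only [Function.comp_apply, htot]
  exact average_mem hconv hT hx

end Supermartingale

/-- With `L` = log(n/δ): the errors sum to less than ε/2, leaving a drift of -ε/2 per step.
Multiplied by βT this is -Tε²/(256n), at most -2(D + nL)/n, which outweighs the initial potential
and leaves -L. -/
theorem rate_exponent_le {D L : ℝ} {n : ℝ} (hn : 1 ≤ n) (hε : 0 < ε) (hε1 : ε ≤ 1) (hD : 0 ≤ D)
    (hlog : Real.log n ≤ L) {T A : ℝ}
    (hT : 512 * (ε ^ 2)⁻¹ * (D + n * L) ≤ T) {o : ℝ} (hA : A ≤ o + ε / 4) :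
    ε / (128 * n) * (T * (A + ε / 4 / 2 +
      n * (2 * (ε / (32 * n)) + 12 * (ε / (128 * n)) * (ε / (32 * n))) + 7 * (ε / (128 * n))
      - (o + ε)) + D / (ε / 4) + Real.log n / (2 * (ε / (32 * n)))) ≤ -L := by
  have hn0 : 0 < n := by linarith
  have hL : 0 ≤ L := (Real.log_nonneg hn).trans hlog
  have hTε : 512 * (D + n * L) ≤ T * ε ^ 2 := by
    have h := mul_le_mul_of_nonneg_right hT (sq_nonneg ε)
    have e : 512 * (ε ^ 2)⁻¹ * (D + n * L) * ε ^ 2 = 512 * (D + n * L) := by field_simp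
    linarith
  have hT0 : 0 ≤ T := by
    refine le_trans ?_ hT
    positivity
  have hs : ε / (128 * n) ≤ ε / 128 := by
    apply div_le_div_of_nonneg_left hε.le (by norm_num); linarith
  have e1 : n * (2 * (ε / (32 * n)) + 12 * (ε / (128 * n)) * (ε / (32 * n))) =
      ε / 16 + 3 / 8 * ε * (ε / (128 * n)) := by field_simp; ring
  have hdrift : A + ε / 4 / 2 +
      n * (2 * (ε / (32 * n)) + 12 * (ε / (128 * n)) * (ε / (32 * n))) + 7 * (ε / (128 * n))
      - (o + ε) ≤ -(ε / 2) := by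
    rw [e1]
    have : ε * (ε / (128 * n)) ≤ ε / 128 := by
      have : 0 ≤ ε / (128 * n) := by positivity
      nlinarith
    linarith
  have h1 := mul_le_mul_of_nonneg_left hdrift hT0
  calc _ ≤ ε / (128 * n) * (T * -(ε / 2) + D / (ε / 4) + Real.log n / (2 * (ε / (32 * n)))) := by
        have : 0 ≤ ε / (128 * n) := by positivity
        gcongr
    _ = (-(T * ε ^ 2) / 2 + 4 * D) / (128 * n) + Real.log n / 8 := by field_simp; ring
    _ ≤ (-(256 * (n * L))) / (128 * n) + L / 8 := by
        gcongr
        linarith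
    _ = -2 * L + L / 8 := by field_simp; ring
    _ ≤ -L := by linarith

theorem output_isEpsOptimal {E : Type*} [NormedAddCommGroup E] [NormedSpace ℝ E]
    [FiniteDimensional ℝ E] {Z : Type*} {n : ℕ} [NeZero n] {k : Fin n → ℕ} [∀ i, NeZero (k i)]
    {Θ : Set E} {ω : E → ℝ} {ω' : E → (E →L[ℝ] ℝ)} {loss : E → Z → ℝ}
    {grad : E → Z → (E →L[ℝ] ℝ)} {θc : E} {ε δ : ℝ} {T : ℕ} (hconv : Convex ℝ Θ)
    (hΘ : IsCompact Θ) (hω : IsDGF Θ ω ω') (hθc : θc ∈ subdiffDomain Θ ω)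
    (hl : IsSmoothConvexLoss Θ loss grad) (B : (i : Fin n) → Fin (k i) → Z) (hε : 0 < ε)
    (hδ : 0 < δ) (hδ1 : δ < 1)
    (hT : 512 * (ε ^ 2)⁻¹ * (bregmanRadius Θ ω ω' θc + n * Real.log (n / δ)) ≤ T) :
    ENNReal.ofReal (1 - δ) ≤
      (output Θ ω ω' θc loss grad (fun i => empirical (B i)) (ε / 4) (2 * (ε / (32 * n)))
        (ε / (32 * n)) T).toOuterMeasure
        {θ | IsEpsOptimal Θ loss (fun i => empirical (B i)) ε θ} := by
  have hn : (1 : ℝ) ≤ n := by exact_mod_cast NeZero.one_le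
  have hn0 : (0 : ℝ) < n := by linarith
  have hlogpos : 0 < Real.log (n / δ) := Real.log_pos ((one_lt_div hδ).2 (by linarith))
  have hlog : Real.log n ≤ Real.log (n / δ) :=
    Real.log_le_log hn0 (le_div_self hn0.le hδ hδ1.le)
  have hD : 0 ≤ bregmanRadius Θ ω ω' θc :=
    (bregman_nonneg hω hθc hθc.1).trans (bregman_le_bregmanRadius hΘ hω θc hθc.1)
  have hT0 : 0 < T := by
    have : (0 : ℝ) < T := lt_of_lt_of_le (by positivity) hT
    exact_mod_cast this
  set p := output Θ ω ω' θc loss grad (fun i => empirical (B i)) (ε / 4) (2 * (ε / (32 * n)))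
    (ε / (32 * n)) T with hp
  have hmem : ∀ θ ∈ p.support, θ ∈ Θ := fun θ hθ =>
    output_mem_of_mem_support hconv hΘ hω hθc hT0 hθ
  set S := {θ | IsEpsOptimal Θ loss (fun i => empirical (B i)) ε θ} with hS
  suffices hbad : p.toOuterMeasure Sᶜ ≤ ENNReal.ofReal δ by
    rw [ENNReal.ofReal_sub _ hδ.le, ENNReal.ofReal_one]
    exact tsub_le_iff_right.2 ((toOuterMeasure_compl_add p S).trans (by gcongr))
  -- For ε ≥ 1 every point of Θ is ε-optimal; otherwise ε < 1 gives the required β ≤ 1/4.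
  rcases le_or_gt 1 ε with hε1 | hε1
  · refine le_of_eq_of_le ?_ (zero_le (a := ENNReal.ofReal δ))
    rw [PMF.toOuterMeasure_apply_eq_zero_iff, Set.disjoint_compl_right_iff_subset]
    exact fun θ hθ => isEpsOptimal_of_one_le hl B hε1 (hmem θ hθ)
  obtain ⟨u, hu, hopt⟩ := exists_worstRisk_lt (loss := loss) ⟨θc, hθc.1⟩
    (fun i => empirical (B i)) (show 0 < ε / 4 by linarith)
  have htail : ∀ i, p.toOuterMeasure {θ | opt Θ loss (fun i => empirical (B i)) + ε <
      risk loss (empirical (B i)) θ} ≤ ENNReal.ofReal (δ / n) := fun i => by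
    -- β = lam/4, the largest value the exponential moment bound allows.
    refine (output_risk_tail (β := ε / (128 * n)) hconv hΘ hω hθc hl B (by positivity)
      (by positivity) (le_of_eq (by field_simp; norm_num)) ?_ hu i hT0).trans
      (ENNReal.ofReal_le_ofReal ?_)
    · rw [div_le_iff₀ (by positivity)]; linarith
    · rw [show δ / n = Real.exp (-Real.log (n / δ)) by
        rw [Real.exp_neg, Real.exp_log (by positivity), inv_div]]
      exact Real.exp_le_exp.2 (rate_exponent_le hn hε hε1.le hD hlog hT hopt.le)
  calc p.toOuterMeasure Sᶜ ≤ p.toOuterMeasure (⋃ i, {θ | opt Θ loss (fun i => empirical (B i)) + ε <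
        risk loss (empirical (B i)) θ}) := by
        -- Monotonicity is needed only on the support, where the output lies in Θ; a failure there
        -- comes from the risk of some group.
        refine PMF.toOuterMeasure_mono p fun θ hθ => ?_
        obtain ⟨hθS, hθp⟩ := hθ
        by_contra hcon
        simp only [Set.mem_iUnion, not_exists] at hcon
        exact hθS ⟨hmem θ hθp, worstRisk_le _ fun i => not_lt.1 (hcon i)⟩
    _ ≤ ∑ i, p.toOuterMeasure {θ | opt Θ loss (fun i => empirical (B i)) + ε <
        risk loss (empirical (B i)) θ} := MeasureTheory.measure_iUnion_fintype_le _ _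
    _ ≤ ∑ _i : Fin n, ENNReal.ofReal (δ / n) := Finset.sum_le_sum fun i _ => htail i
    _ = ENNReal.ofReal δ := by
        rw [Finset.sum_const, Finset.card_univ, Fintype.card_fin, nsmul_eq_mul,
          ← ENNReal.ofReal_natCast, ← ENNReal.ofReal_mul hn0.le, mul_div_cancel₀ _ hn0.ne']

end GroupDRO

theorem mainTheorem9 :
    ∃ C : ℝ, 0 < C ∧
      ∀ (E : Type*) [NormedAddCommGroup E] [NormedSpace ℝ E] [FiniteDimensional ℝ E]
        (Θ : Set E) (ω : E → ℝ) (ω' : E → (E →L[ℝ] ℝ)) (θc : E)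
        (n : ℕ) [NeZero n] (ε δ : ℝ) (T : ℕ),
        Convex ℝ Θ → IsCompact Θ →
        GroupDRO.IsDGF Θ ω ω' → GroupDRO.IsCenter Θ ω θc →
        0 < ε → 0 < δ → δ < 1 →
        C * (ε ^ 2)⁻¹ * (GroupDRO.bregmanRadius Θ ω ω' θc + n * Real.log (n / δ)
          + Metric.diam Θ * Real.log (1 / δ)) ≤ T →
        ∃ η κ lam : ℝ, 0 < η ∧ 0 < κ ∧ 0 < lam ∧
          ∀ (Z : Type*) (loss : E → Z → ℝ) (grad : E → Z → (E →L[ℝ] ℝ)),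
            GroupDRO.IsSmoothConvexLoss Θ loss grad →
            ∀ (k : Fin n → ℕ) [∀ i, NeZero (k i)] (B : (i : Fin n) → Fin (k i) → Z),
              ENNReal.ofReal (1 - δ) ≤
                (GroupDRO.output Θ ω ω' θc loss grad (fun i => GroupDRO.empirical (B i))
                  η κ lam T).toOuterMeasure
                  {θ | GroupDRO.IsEpsOptimal Θ loss
                    (fun i => GroupDRO.empirical (B i)) ε θ} := by
  refine ⟨512, by norm_num, ?_⟩
  intro E _ _ _ Θ ω ω' θc n _ ε δ T hconv hΘ hω hθc hε hδ hδ1 hT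
  have hn : (0 : ℝ) < n := by exact_mod_cast Nat.pos_of_ne_zero (NeZero.ne n)
  refine ⟨ε / 4, 2 * (ε / (32 * n)), ε / (32 * n), by positivity, by positivity, by positivity,
    fun Z loss grad hl k _ B =>
      GroupDRO.output_isEpsOptimal hconv hΘ hω hθc.1 hl B hε hδ hδ1 (le_trans ?_ hT)⟩
  have hdiam : 0 ≤ Metric.diam Θ * Real.log (1 / δ) :=
    mul_nonneg Metric.diam_nonneg (Real.log_nonneg ((one_le_div hδ).2 hδ1.le))
  exact mul_le_mul_of_nonneg_left (by linarith) (by positivity)
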